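/- **Conventions.** All Hilbert spaces are finite-dimensional, $\mathscr L(H)$ denotes the operators on $H$, $\mathscr P(H)$ the positive semidefinite operators and $\mathscr D(H)$ the density operators (positive semidefinite, trace one). Logarithms are in base $2$, with $\log 0=-\infty$, and powers of positive semidefinite operators with negative exponent are powers of the generalized inverse (the inverse on the support). Let $\alpha\in(1,\infty)$. For $\rho,\sigma\in\mathscr P(H)$ the sandwiched Rényi divergence is $$\widetilde D_\alpha(\rho\|\sigma)=\frac1{\alpha-1}\log\operatorname{tr}\Big(\big(\sigma^{\frac{1-\alpha}{2\alpha}}\rho\,\sigma^{\frac{1-\alpha}{2\alpha}}\big)^{\alpha}\Big)\quad\text{if }\operatorname{supp}\rho\subseteq\operatorname{supp}\sigma,\qquad \widetilde D_\alpha(\rho\|\sigma)=+\infty\ \text{otherwise.}$$ For a linear map $\mathcal N:\mathscr L(X)\to\mathscr L(Y)$, with a fixed orthonormal basis $\{|x\rangle\}$ of $X$, let $J^{\mathcal N}=\sum_{x,x'}|x\rangle\langle x'|\otimes\mathcal N(|x\rangle\langle x'|)$ be its Choi operator on $X\otimes Y$. For completely positive maps $\mathcal N,\mathcal M:\mathscr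 L(X)\to\mathscr L(Y)$ define, with values in $[-\infty,+\infty]$: * the channel divergence $$\widetilde D_\alpha(\mathcal N\|\mathcal M)=\sup_{\omega\in\mathscr D(X)}\widetilde D_\alpha\big((\omega^{1/2}\otimes I_Y)J^{\mathcal N}(\omega^{1/2}\otimes I_Y)\,\big\|\,(\omega^{1/2}\otimes I_Y)J^{\mathcal M}(\omega^{1/2}\otimes I_Y)\big);$$ * the regularized channel divergence $$\widetilde D^{\mathrm{reg}}_\alpha(\mathcal N\|\mathcal M)=\lim_{n\to\infty}\frac1n\widetilde D_\alpha(\mathcal N^{\otimes n}\|\mathcal M^{\otimes n});$$ * the amortized channel divergence $$\widetilde D^{\mathrm a}_\alpha(\mathcal N\|\mathcal M)=\sup_{R}\ \sup_{\rho,\sigma\in\mathscr D(R\otimes X)}\Big(\widetilde D_\alpha\big((\mathcal I_R\otimes\mathcal N)(\rho)\,\big\|\,(\mathcal I_R\otimes\mathcal M)(\sigma)\big)-\widetilde D_\alpha(\rho\|\sigma)\Big),$$ where $R$ runs over all finite-dimensional Hilbert spaces, $\mathcal I_R$ is the identity map on $\mathscr L(R)$, and the difference is read as $-\infty$ when $\widetilde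 D_\alpha(\rho\|\sigma)=+\infty$ (so that such pairs do not contribute). **Theorem (amortization = regularization for the sandwiched divergence).** For all completely positive maps $\mathcal N,\mathcal M:\mathscr L(X)\to\mathscr L(Y)$ and all $\alpha>1$, the limit defining $\widetilde D^{\mathrm{reg}}_\alpha(\mathcal N\|\mathcal M)$ exists in $[-\infty,+\infty]$, and $$\widetilde D^{\mathrm a}_\alpha(\mathcal N\|\mathcal M)=\widetilde D^{\mathrm{reg}}_\alpha(\mathcal N\|\mathcal M).$$ -/

import Mathlib

open scoped ComplexOrder Kronecker

noncomputable section

namespace QDiv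

/-! Finite-dimensional Hilbert spaces are `ℂ^n` for a finite index type `n`; operators on `ℂ^n` are
the matrices `Matrix n n ℂ`. The tensor product of `ℂ^m` and `ℂ^n` is indexed by `m × n`, and the
`k`-fold tensor power of `ℂ^n` by `Fin k → n`. -/

section States

variable {n : Type*} [Fintype n] [DecidableEq n]

/-- Density operators: positive semidefinite operators of trace one. -/
def IsDensity (ρ : Matrix n n ℂ) : Prop :=
  ρ.PosSemidef ∧ ρ.trace = 1

/-- Real powers of a positive semidefinite operator through the functional calculus. As
`0 ^ s = 0` in `ℝ` for `s ≠ 0`, a negative power is the power of the generalized inverse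
(the inverse on the support). -/
def mpow (A : Matrix n n ℂ) (s : ℝ) : Matrix n n ℂ :=
  cfc (fun t : ℝ => t ^ s) A

/-- `supp ρ ⊆ supp σ`, where the support of a positive semidefinite operator, i.e. the orthogonal
complement of its kernel, is its range. -/
def SuppLE (ρ σ : Matrix n n ℂ) : Prop :=
  LinearMap.range ρ.mulVecLin ≤ LinearMap.range σ.mulVecLin

/-- The base-two logarithm on `[0, ∞)`, with `log 0 = -∞`. -/
def elog (x : ℝ) : EReal :=
  if x ≤ 0 then ⊥ else (Real.logb 2 x : ℝ)

open Classical in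
/-- The sandwiched Rényi divergence of order `α` of two positive semidefinite operators,
`(α - 1)⁻¹ log tr ((σ^((1-α)/(2α)) ρ σ^((1-α)/(2α)))^α)` if `supp ρ ⊆ supp σ`, and `∞` otherwise
(no correction when the operators are not normalized). -/
def sandwiched (α : ℝ) (ρ σ : Matrix n n ℂ) : EReal :=
  if SuppLE ρ σ then
    ((1 / (α - 1) : ℝ) : EReal) *
      elog (Matrix.trace (mpow (mpow σ ((1 - α) / (2 * α)) * ρ * mpow σ ((1 - α) / (2 * α))) α)).re
  else ⊤

end States

section Maps

variable {X Y : Type*} [Fintype X] [DecidableEq X] [Fintype Y] [DecidableEq Y]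

/-- `(I_R ⊗ N)(A)` for a linear map `N` on operators and an operator `A` on `R ⊗ X`: the map `N` is
applied to each `X`-block of `A`. -/
def ampliation (R : Type*) (N : Matrix X X ℂ →ₗ[ℂ] Matrix Y Y ℂ)
    (A : Matrix (R × X) (R × X) ℂ) : Matrix (R × Y) (R × Y) ℂ :=
  Matrix.of fun p q => N (Matrix.of fun x x' => A (p.1, x) (q.1, x')) p.2 q.2

/-- Complete positivity: every `I_k ⊗ N` preserves positive semidefiniteness. -/
def IsCompletelyPositive (N : Matrix X X ℂ →ₗ[ℂ] Matrix Y Y ℂ) : Prop :=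
  ∀ (k : ℕ) (A : Matrix (Fin k × X) (Fin k × X) ℂ), A.PosSemidef →
    (ampliation (Fin k) N A).PosSemidef

/-- The Choi operator `J^N = ∑ x x', |x⟩⟨x'| ⊗ N(|x⟩⟨x'|)` on `X ⊗ Y`. -/
def choi (N : Matrix X X ℂ →ₗ[ℂ] Matrix Y Y ℂ) : Matrix (X × Y) (X × Y) ℂ :=
  ∑ x : X, ∑ x' : X, Matrix.single x x' (1 : ℂ) ⊗ₖ N (Matrix.single x x' 1)

/-- The tensor power `N^{⊗ k}`, the linear map with
`|x₁ ⋯ x_k⟩⟨x₁' ⋯ x_k'| ↦ N(|x₁⟩⟨x₁'|) ⊗ ⋯ ⊗ N(|x_k⟩⟨x_k'|)`. -/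
def tensorPower (k : ℕ) (N : Matrix X X ℂ →ₗ[ℂ] Matrix Y Y ℂ) :
    Matrix (Fin k → X) (Fin k → X) ℂ →ₗ[ℂ] Matrix (Fin k → Y) (Fin k → Y) ℂ where
  toFun A := Matrix.of fun y y' => ∑ x : Fin k → X, ∑ x' : Fin k → X,
    A x x' * ∏ i, N (Matrix.single (x i) (x' i) 1) (y i) (y' i)
  map_add' A B := by
    ext y y'
    simp [add_mul, Finset.sum_add_distrib]
  map_smul' c A := by
    ext y y'
    simp [Finset.mul_sum, mul_assoc]

/-- The (stabilized) sandwiched channel divergence: the supremum over the density operators `ω` on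
`X` of the divergence of `ω^{1/2} J^N ω^{1/2}` and `ω^{1/2} J^M ω^{1/2}`, where `ω^{1/2}` stands for
`ω^{1/2} ⊗ I_Y`. -/
def channelDiv (α : ℝ) (N M : Matrix X X ℂ →ₗ[ℂ] Matrix Y Y ℂ) : EReal :=
  ⨆ (ω : Matrix X X ℂ) (_ : IsDensity ω),
    sandwiched α
      ((mpow ω (1 / 2) ⊗ₖ (1 : Matrix Y Y ℂ)) * choi N * (mpow ω (1 / 2) ⊗ₖ (1 : Matrix Y Y ℂ)))
      ((mpow ω (1 / 2) ⊗ₖ (1 : Matrix Y Y ℂ)) * choi M * (mpow ω (1 / 2) ⊗ₖ (1 : Matrix Y Y ℂ)))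

/-- The sequence `n⁻¹ D(N^{⊗ n} ‖ M^{⊗ n})`. -/
def normalizedDiv (α : ℝ) (N M : Matrix X X ℂ →ₗ[ℂ] Matrix Y Y ℂ) (n : ℕ) : EReal :=
  ((1 / (n : ℝ) : ℝ) : EReal) * channelDiv α (tensorPower n N) (tensorPower n M)

/-- The regularized sandwiched channel divergence `lim_n n⁻¹ D(N^{⊗ n} ‖ M^{⊗ n})`. -/
def regularizedDiv (α : ℝ) (N M : Matrix X X ℂ →ₗ[ℂ] Matrix Y Y ℂ) : EReal :=
  Filter.limUnder Filter.atTop (normalizedDiv α N M)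

/-- The amortized sandwiched channel divergence: the supremum of
`D((I_R ⊗ N)(ρ) ‖ (I_R ⊗ M)(σ)) - D(ρ ‖ σ)` over all finite-dimensional `R` and all density
operators `ρ`, `σ` on `R ⊗ X`. In `EReal` one has `a - ∞ = -∞` for every `a`, also for `a = ∞`, so
that the pairs with `D(ρ ‖ σ) = ∞` do not contribute. -/
def amortizedDiv (α : ℝ) (N M : Matrix X X ℂ →ₗ[ℂ] Matrix Y Y ℂ) : EReal :=
  ⨆ (r : ℕ) (ρ : Matrix (Fin r × X) (Fin r × X) ℂ) (σ : Matrix (Fin r × X) (Fin r × X) ℂ)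
    (_ : IsDensity ρ) (_ : IsDensity σ),
    sandwiched α (ampliation (Fin r) N ρ) (ampliation (Fin r) M σ) - sandwiched α ρ σ

end Maps

end QDiv

end

set_option linter.unusedSectionVars false

noncomputable section

namespace QDiv

open Matrix

/-! ### Real functional calculus on matrices, and trace inequalities for powers. -/

section FunctionalCalculus

variable {m n : Type*} [Fintype m] [DecidableEq m] [Fintype n] [DecidableEq n]

/-! Write Q(A‖B) for the trace inside the logarithm (`sandwichedQ`). A bound c on a divergence is
the same as an inclusion of supports together with Q ≤ 2^((α-1)c); this form is multiplicative under
tensor powers and allows unnormalized operators. The limit exists because the amortized divergence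
bounds every term with k ≥ 1 from above, while it is itself bounded by the liminf.

Upper bound on the terms. N^{⊗k} is applied one factor at a time, the untouched inputs and the
outputs already produced serving as reference. Each use costs at most the amortized factor K, so K^k
bounds N^{⊗k} against M^{⊗k} (`IsAmortizedBound.tensorPower`). Feeding the same purification of ω to
both maps, whose input quantity is at most 1, gives the channel divergence
(`channelDiv_le_of_isAmortizedBound`).

Bound by the liminf. This is a chain rule with a polynomial loss
(`sandwichedQ_pow_le_of_positive_maps`). Pinching ρ^{⊗k} by σ^{⊗k}, which has polynomially many
distinct eigenvalues, replaces the inputs by combinations ∑ a_x u_x u_xᴴ and ∑ b_x u_x u_xᴴ of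
common orthogonal pure states. On each u_x u_xᴴ the outputs are controlled by the channel divergence
of the tensor powers, since every purification differs from the canonical one by a partial isometry
on the reference. A second pinching on the output side turns Q into a classical sum, where joint
convexity of x^α y^(1-α) separates the input coefficients from the pure-state outputs. Data
processing under rank-one measurements, itself proved by pinching tensor powers, returns from the
classical sums to Q. The polynomial factors disappear on taking k-th roots
(`le_of_frequently_pow_le`), for which infinitely many k are enough. -/

theorem exists_polynomial_eqOn {s : Set ℝ} (hs : s.Finite) (f : ℝ → ℝ) :
    ∃ p : Polynomial ℝ, ∀ x ∈ s, p.eval x = f x :=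
  ⟨Lagrange.interpolate hs.toFinset id f, fun _ hx =>
    Lagrange.eval_interpolate_at_node f (Set.injOn_id _) (hs.mem_toFinset.2 hx)⟩

theorem cfc_eq_aeval {A : Matrix n n ℂ} (hA : A.IsHermitian) {f : ℝ → ℝ} {p : Polynomial ℝ}
    (h : ∀ x ∈ spectrum ℝ A, p.eval x = f x) : cfc f A = Polynomial.aeval A p := by
  rw [← cfc_polynomial p A hA]
  exact cfc_congr fun x hx => (h x hx).symm

theorem aeval_X_mul_monomial (A : Matrix n n ℂ) (k : ℕ) (a : ℝ) :
    Polynomial.aeval A (Polynomial.X * Polynomial.monomial k a) = a • A ^ (k + 1) := by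
  rw [Polynomial.X_mul_monomial, Polynomial.aeval_monomial, Algebra.smul_def]

/-- The hypothesis says that `W` is isometric on the range of `B`. The factor `X` excludes the
constant term, the only one that fails to pass through the conjugation. -/
theorem aeval_X_mul_conj {B : Matrix n n ℂ} {W : Matrix m n ℂ} (hW : Wᴴ * W * B = B)
    (q : Polynomial ℝ) :
    Polynomial.aeval (W * B * Wᴴ) (Polynomial.X * q) =
      W * Polynomial.aeval B (Polynomial.X * q) * Wᴴ := by
  induction q using Polynomial.induction_on' with
  | add p q hp hq => simp only [mul_add, map_add, hp, hq, Matrix.mul_add, Matrix.add_mul]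
  | monomial k a =>
    have h : ∀ k : ℕ, (W * B * Wᴴ) ^ (k + 1) = W * B ^ (k + 1) * Wᴴ := by
      intro k
      induction k with
      | zero => simp
      | succ k ih =>
        calc (W * B * Wᴴ) ^ (k + 1 + 1) = W * B ^ (k + 1) * (Wᴴ * W * B) * Wᴴ := by
              rw [pow_succ, ih]; simp only [Matrix.mul_assoc]
          _ = _ := by rw [hW, Matrix.mul_assoc W, ← pow_succ]
    rw [aeval_X_mul_monomial, aeval_X_mul_monomial, h, Matrix.mul_smul, Matrix.smul_mul]

theorem cfc_conj {B : Matrix n n ℂ} (hB : B.IsHermitian) {W : Matrix m n ℂ}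
    (hW : Wᴴ * W * B = B) {f : ℝ → ℝ} (hf : f 0 = 0) :
    cfc f (W * B * Wᴴ) = W * cfc f B * Wᴴ := by
  have hB' : (W * B * Wᴴ).IsHermitian := isHermitian_mul_mul_conjTranspose W hB
  -- One polynomial serves both finite spectra; interpolating at 0 as well makes it divisible by
  -- `X`.
  obtain ⟨p, hp⟩ := exists_polynomial_eqOn
    (((B.finite_real_spectrum).union (W * B * Wᴴ).finite_real_spectrum).insert 0) f
  obtain ⟨q, rfl⟩ : Polynomial.X ∣ p := by
    rw [Polynomial.X_dvd_iff, Polynomial.coeff_zero_eq_eval_zero, hp 0 (by simp), hf]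
  rw [cfc_eq_aeval hB' fun x hx => hp x (by simp [hx]),
    cfc_eq_aeval hB fun x hx => hp x (by simp [hx]), aeval_X_mul_conj hW]

theorem cfc_diagonal (d : n → ℝ) (f : ℝ → ℝ) :
    cfc f (diagonal fun i => (d i : ℂ)) = diagonal fun i => (f (d i) : ℂ) := by
  have hd : (diagonal fun i => (d i : ℂ)).IsHermitian :=
    isHermitian_diagonal_of_self_adjoint _ (by ext; simp)
  obtain ⟨p, hp⟩ := exists_polynomial_eqOn
    (((diagonal fun i => (d i : ℂ)).finite_real_spectrum).union (Set.finite_range d)) f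
  rw [cfc_eq_aeval hd fun x hx => hp x (by simp [hx])]
  have h : ∀ i, f (d i) = p.eval (d i) := fun i => (hp _ (by simp)).symm
  simp only [h]
  clear h hp
  induction p using Polynomial.induction_on' with
  | add p q hp hq => simp [hp, hq]
  | monomial k a =>
    rw [Polynomial.aeval_monomial, ← Algebra.smul_def, diagonal_pow]
    ext i j
    by_cases hij : i = j <;> simp [hij]

theorem mul_conjTranspose_eq_one {U : Matrix n n ℂ} (hU : Uᴴ * U = 1) : U * Uᴴ = 1 :=
  mul_eq_one_comm.1 hU

theorem exists_diagonalization {A : Matrix n n ℂ} (hA : A.IsHermitian) :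
    ∃ (U : Matrix n n ℂ) (d : n → ℝ), Uᴴ * U = 1 ∧
      A = U * (diagonal fun i => (d i : ℂ)) * Uᴴ := by
  refine ⟨hA.eigenvectorUnitary, hA.eigenvalues, ?_, ?_⟩
  · exact Unitary.coe_star_mul_self hA.eigenvectorUnitary
  · conv_lhs => rw [hA.spectral_theorem]
    rfl

theorem conj_diagonal_apply (U : Matrix m n ℂ) (d : n → ℝ) (l l' : m) :
    (U * (diagonal fun i => (d i : ℂ)) * Uᴴ) l l' = ∑ i, U l i * d i * star (U l' i) := by
  rw [Matrix.mul_apply]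
  simp [mul_diagonal]

theorem conj_diagonal_diag_re (U : Matrix m n ℂ) (d : n → ℝ) (l : m) :
    ((U * (diagonal fun i => (d i : ℂ)) * Uᴴ) l l).re = ∑ i, ‖U l i‖ ^ 2 * d i := by
  rw [conj_diagonal_apply, Complex.re_sum]
  refine Finset.sum_congr rfl fun i _ => ?_
  rw [mul_right_comm, Complex.star_def, Complex.mul_conj, Complex.normSq_eq_norm_sq]
  rw [← Complex.ofReal_mul, Complex.ofReal_re]

theorem unitary_cancel {U : Matrix n n ℂ} (hU : Uᴴ * U = 1) (D : Matrix n n ℂ) :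
    Uᴴ * (U * D * Uᴴ) * U = D := by
  calc Uᴴ * (U * D * Uᴴ) * U = (Uᴴ * U) * D * (Uᴴ * U) := by simp only [Matrix.mul_assoc]
    _ = D := by simp [hU]

theorem unitary_cancel' {U : Matrix n n ℂ} (hU : Uᴴ * U = 1) (D : Matrix n n ℂ) :
    U * (Uᴴ * D * U) * Uᴴ = D := by
  have := unitary_cancel (U := Uᴴ)
    (by rw [conjTranspose_conjTranspose, mul_conjTranspose_eq_one hU]) D
  rwa [conjTranspose_conjTranspose] at this

theorem posSemidef_diagonal_ofReal {d : n → ℝ} (hd : ∀ i, 0 ≤ d i) :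
    (diagonal fun i => (d i : ℂ)).PosSemidef :=
  posSemidef_diagonal_iff.2 fun i => by exact_mod_cast hd i

theorem posSemidef_conj_diagonal (U : Matrix m n ℂ) {d : n → ℝ} (hd : ∀ i, 0 ≤ d i) :
    (U * (diagonal fun i => (d i : ℂ)) * Uᴴ).PosSemidef :=
  (posSemidef_diagonal_ofReal hd).mul_mul_conjTranspose_same U

theorem nonneg_of_posSemidef_conj_diagonal {U : Matrix n n ℂ} (hU : Uᴴ * U = 1) {d : n → ℝ}
    (h : (U * (diagonal fun i => (d i : ℂ)) * Uᴴ).PosSemidef) (i : n) : 0 ≤ d i := by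
  have := h.conjTranspose_mul_mul_same U
  rw [unitary_cancel hU, posSemidef_diagonal_iff] at this
  exact_mod_cast this i

theorem diag_re_nonneg {A : Matrix n n ℂ} (hA : A.PosSemidef) (i : n) : 0 ≤ (A i i).re :=
  (Complex.le_def.1 (hA.diag_nonneg (i := i))).1

theorem trace_re_nonneg {A : Matrix n n ℂ} (hA : A.PosSemidef) : 0 ≤ A.trace.re :=
  (Complex.le_def.1 hA.trace_nonneg).1

theorem trace_conj {U : Matrix m n ℂ} (hU : Uᴴ * U = 1) (D : Matrix n n ℂ) :
    (U * D * Uᴴ).trace = D.trace := by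
  rw [trace_mul_comm, ← Matrix.mul_assoc, hU, Matrix.one_mul]

theorem mpow_conj {B : Matrix n n ℂ} (hB : B.IsHermitian) {W : Matrix m n ℂ}
    (hW : Wᴴ * W * B = B) {s : ℝ} (hs : s ≠ 0) : mpow (W * B * Wᴴ) s = W * mpow B s * Wᴴ :=
  cfc_conj hB hW (Real.zero_rpow hs)

theorem isHermitian_diagonal_ofReal (d : n → ℝ) : (diagonal fun i => (d i : ℂ)).IsHermitian :=
  isHermitian_diagonal_of_self_adjoint _ (by ext; simp)

theorem mpow_conj_diagonal {U : Matrix m n ℂ} (hU : Uᴴ * U = 1) (d : n → ℝ) {s : ℝ}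
    (hs : s ≠ 0) : mpow (U * (diagonal fun i => (d i : ℂ)) * Uᴴ) s =
      U * (diagonal fun i => ((d i ^ s : ℝ) : ℂ)) * Uᴴ := by
  rw [mpow_conj (isHermitian_diagonal_ofReal d) (by rw [hU, Matrix.one_mul]) hs, mpow, cfc_diagonal]

theorem isHermitian_mpow (A : Matrix n n ℂ) (s : ℝ) : (mpow A s).IsHermitian :=
  cfc_predicate (R := ℝ) _ A

theorem mpow_mul_mul_posSemidef {A : Matrix n n ℂ} (hA : A.PosSemidef) (B : Matrix n n ℂ) (s : ℝ) :
    (mpow B s * A * mpow B s).PosSemidef := by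
  have := hA.mul_mul_conjTranspose_same (mpow B s)
  rwa [(isHermitian_mpow B s).eq] at this

theorem exists_diagonalization_nonneg {A : Matrix n n ℂ} (hA : A.PosSemidef) :
    ∃ (U : Matrix n n ℂ) (d : n → ℝ), Uᴴ * U = 1 ∧ (∀ i, 0 ≤ d i) ∧
      A = U * (diagonal fun i => (d i : ℂ)) * Uᴴ := by
  obtain ⟨U, d, hU, h⟩ := exists_diagonalization hA.1
  exact ⟨U, d, hU, nonneg_of_posSemidef_conj_diagonal hU (h ▸ hA), h⟩

theorem sum_norm_sq_row {U : Matrix n n ℂ} (hU : Uᴴ * U = 1) (l : n) : ∑ i, ‖U l i‖ ^ 2 = 1 := by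
  have h := conj_diagonal_diag_re U (fun _ => 1) l
  simp only [Complex.ofReal_one, diagonal_one, mul_one,
    mul_conjTranspose_eq_one hU, one_apply_eq, Complex.one_re] at h
  exact h.symm

theorem sum_norm_sq_col {U : Matrix n n ℂ} (hU : Uᴴ * U = 1) (l : n) : ∑ i, ‖U i l‖ ^ 2 = 1 := by
  have := sum_norm_sq_row (U := Uᴴ)
    (by rw [conjTranspose_conjTranspose, mul_conjTranspose_eq_one hU]) l
  simpa using this

/-- Peierls' inequality for the power function. -/
theorem sum_diag_rpow_le_trace {A U : Matrix n n ℂ} (hA : A.PosSemidef) (hU : Uᴴ * U = 1) {α : ℝ}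
    (hα : 1 < α) : ∑ l, ((Uᴴ * A * U) l l).re ^ α ≤ (mpow A α).trace.re := by
  obtain ⟨V, d, hV, hd, rfl⟩ := exists_diagonalization_nonneg hA
  have hα0 : α ≠ 0 := by positivity
  rw [mpow_conj_diagonal hV d hα0, trace_conj hV, trace_diagonal, Complex.re_sum]
  simp only [Complex.ofReal_re]
  set T := Uᴴ * V with hT
  have hTT : Tᴴ * T = 1 := by
    rw [hT, conjTranspose_mul, conjTranspose_conjTranspose, Matrix.mul_assoc, ← Matrix.mul_assoc U,
      mul_conjTranspose_eq_one hU, Matrix.one_mul, hV]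
  have key : ∀ l, ((Uᴴ * (V * (diagonal fun i => (d i : ℂ)) * Vᴴ) * U) l l).re ^ α ≤
      ∑ i, ‖T l i‖ ^ 2 * d i ^ α := by
    intro l
    have : Uᴴ * (V * (diagonal fun i => (d i : ℂ)) * Vᴴ) * U =
        T * (diagonal fun i => (d i : ℂ)) * Tᴴ := by
      rw [hT, conjTranspose_mul, conjTranspose_conjTranspose]; simp only [Matrix.mul_assoc]
    rw [this, conj_diagonal_diag_re]
    -- Jensen: row `l` of the unitary `T` gives probability weights `‖T l i‖ ^ 2`. Its columns also
    -- sum to one, which evaluates the final double sum.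
    have := (convexOn_rpow hα.le).map_sum_le (t := Finset.univ) (w := fun i => ‖T l i‖ ^ 2) (p := d)
      (fun i _ => by positivity) (sum_norm_sq_row hTT l) (fun i _ => hd i)
    simpa using this
  calc _ ≤ ∑ l, ∑ i, ‖T l i‖ ^ 2 * d i ^ α := Finset.sum_le_sum fun l _ => key l
    _ = _ := by
      rw [Finset.sum_comm]
      refine Finset.sum_congr rfl fun i _ => ?_
      rw [← Finset.sum_mul, sum_norm_sq_col hTT, one_mul]

/-- For large α the power is not operator monotone, but the trace is: the diagonals of A and B are
compared in an eigenbasis of A, and Peierls' inequality is applied to B. -/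
theorem trace_mpow_mono {A B : Matrix n n ℂ} (hA : A.PosSemidef) (hAB : (B - A).PosSemidef) {α : ℝ}
    (hα : 1 < α) : (mpow A α).trace.re ≤ (mpow B α).trace.re := by
  have hB : B.PosSemidef := by simpa using hA.add hAB
  obtain ⟨V, d, hV, hd, rfl⟩ := exists_diagonalization_nonneg hA
  refine le_trans ?_ (sum_diag_rpow_le_trace hB hV hα)
  rw [mpow_conj_diagonal hV d (by positivity), trace_conj hV, trace_diagonal, Complex.re_sum]
  refine Finset.sum_le_sum fun l _ => ?_
  have h := diag_re_nonneg (hAB.conjTranspose_mul_mul_same V) l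
  rw [Matrix.mul_sub, Matrix.sub_mul, unitary_cancel hV, Matrix.sub_apply, diagonal_apply_eq,
    Complex.sub_re, Complex.ofReal_re] at h
  rw [Complex.ofReal_re]
  exact Real.rpow_le_rpow (hd l) (by linarith) (by positivity)

end FunctionalCalculus

/-! ### Inclusion of supports through kernels and quadratic forms. -/

section Support

variable {m n : Type*} [Fintype m] [DecidableEq m] [Fintype n] [DecidableEq n]

theorem suppLE_of_eq_mul {A B X : Matrix n n ℂ} (h : A = B * X) : SuppLE A B := by
  rintro _ ⟨v, rfl⟩
  exact ⟨X *ᵥ v, by simp [h]⟩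

theorem SuppLE.exists_eq_mul {A B : Matrix n n ℂ} (h : SuppLE A B) : ∃ X, A = B * X := by
  have h' : ∀ j, ∃ v, B *ᵥ v = A *ᵥ Pi.single j 1 := fun j => h ⟨Pi.single j 1, rfl⟩
  choose v hv using h'
  refine ⟨of fun i j => v j i, ?_⟩
  ext i j
  have := congrFun (hv j) i
  simp only [mulVec_single_one, col_apply] at this
  rw [← this, Matrix.mul_apply]
  rfl

theorem mul_eq_zero_of_suppLE {A B : Matrix n n ℂ} (hA : A.IsHermitian) (hB : B.IsHermitian)
    (h : SuppLE A B) {V : Matrix n m ℂ} (hV : B * V = 0) : A * V = 0 := by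
  obtain ⟨X, hX⟩ := h.exists_eq_mul
  rw [← hA.eq, hX, conjTranspose_mul, hB.eq, Matrix.mul_assoc, hV, Matrix.mul_zero]

theorem suppLE_of_mul_eq_zero {A B : Matrix n n ℂ} (hA : A.IsHermitian) (hB : B.IsHermitian)
    (h : ∀ V : Matrix n n ℂ, B * V = 0 → A * V = 0) : SuppLE A B := by
  obtain ⟨U, d, hU, rfl⟩ := exists_diagonalization hB
  set D : Matrix n n ℂ := diagonal fun i => (d i : ℂ)
  -- As `0⁻¹ = 0`, `E` is the generalized inverse of `D`, and `U * (D * E) * Uᴴ` is the projection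
  -- onto the range of `B`. Its complement is killed by `B`, hence by `A`.
  set E : Matrix n n ℂ := diagonal fun i => ((d i)⁻¹ : ℂ)
  have hDED : D * (E * D) = D := by
    rw [diagonal_mul_diagonal, diagonal_mul_diagonal]
    congr 1; ext i
    by_cases hd : (d i : ℂ) = 0
    · simp [hd]
    · field_simp
  have hDE : D * E = E * D := by simp [D, E, diagonal_mul_diagonal, mul_comm]
  have hP : (U * (D * E) * Uᴴ).IsHermitian := by
    have : D * E = diagonal fun i => ((d i * (d i)⁻¹ : ℝ) : ℂ) := by
      simp [D, E, diagonal_mul_diagonal]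
    rw [this]
    exact isHermitian_mul_mul_conjTranspose U (isHermitian_diagonal_ofReal _)
  have h1 : U * D * Uᴴ * (1 - U * (D * E) * Uᴴ) = 0 := by
    rw [Matrix.mul_sub, Matrix.mul_one, sub_eq_zero]
    calc U * D * Uᴴ = U * (D * (E * D)) * Uᴴ := by rw [hDED]
      _ = U * D * (Uᴴ * U) * (D * E) * Uᴴ := by
        rw [hU, Matrix.mul_one, ← hDE, Matrix.mul_assoc U D]
      _ = _ := by simp only [Matrix.mul_assoc]
  have h2 := h _ h1
  rw [Matrix.mul_sub, Matrix.mul_one, sub_eq_zero] at h2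
  have h3 : A = U * (D * E) * Uᴴ * A := by
    have := congrArg conjTranspose h2
    rwa [conjTranspose_mul, hP.eq, hA.eq] at this
  refine suppLE_of_eq_mul (X := U * E * Uᴴ * A) ?_
  calc A = U * D * (1 : Matrix n n ℂ) * E * Uᴴ * A := by
        rw [Matrix.mul_one, Matrix.mul_assoc U D]; exact h3
    _ = _ := by rw [← hU]; simp only [Matrix.mul_assoc]

theorem mul_eq_zero_iff_trace {A : Matrix n n ℂ} (hA : A.PosSemidef) (V : Matrix n m ℂ) :
    A * V = 0 ↔ (Vᴴ * A * V).trace.re = 0 := by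
  constructor
  · intro h
    rw [Matrix.mul_assoc, h]; simp
  · intro h
    obtain ⟨U, d, hU, hd, rfl⟩ := exists_diagonalization_nonneg hA
    set R : Matrix n n ℂ := diagonal fun i => ((Real.sqrt (d i) : ℝ) : ℂ)
    have hR : Rᴴ = R := (isHermitian_diagonal_ofReal _).eq
    have hRR : (diagonal fun i => (d i : ℂ)) = R * R := by
      simp only [R, diagonal_mul_diagonal]
      congr 1; ext i
      rw [← Complex.ofReal_mul, Real.mul_self_sqrt (hd i)]
    have hpsd := (hA.conjTranspose_mul_mul_same V).trace_nonneg
    have h0 : (Vᴴ * (U * (diagonal fun i => (d i : ℂ)) * Uᴴ) * V).trace = 0 :=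
      Complex.ext h (Complex.le_def.1 hpsd).2.symm
    have h1 : ((R * Uᴴ * V)ᴴ * (R * Uᴴ * V)).trace = 0 := by
      rw [← h0, hRR, conjTranspose_mul, conjTranspose_mul, hR, conjTranspose_conjTranspose]
      simp only [Matrix.mul_assoc]
    have h2 := trace_conjTranspose_mul_self_eq_zero_iff.1 h1
    rw [hRR]
    calc U * (R * R) * Uᴴ * V = U * R * (R * Uᴴ * V) := by simp only [Matrix.mul_assoc]
      _ = 0 := by rw [h2, Matrix.mul_zero]

/-- Inclusion of supports in terms of quadratic forms. -/
theorem suppLE_iff {A B : Matrix n n ℂ} (hA : A.PosSemidef) (hB : B.PosSemidef) :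
    SuppLE A B ↔ ∀ v : Matrix n Unit ℂ,
      (vᴴ * B * v).trace.re = 0 → (vᴴ * A * v).trace.re = 0 := by
  constructor
  · intro h v hv
    rw [← mul_eq_zero_iff_trace hA]
    rw [← mul_eq_zero_iff_trace hB] at hv
    exact mul_eq_zero_of_suppLE hA.1 hB.1 h hv
  · intro h
    refine suppLE_of_mul_eq_zero hA.1 hB.1 fun V hV => ?_
    have key : ∀ j, A * V.submatrix id (fun _ : Unit => j) = 0 := by
      intro j
      rw [mul_eq_zero_iff_trace hA]
      refine h _ ((mul_eq_zero_iff_trace hB _).1 ?_)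
      ext i u
      exact congrFun (congrFun hV i) j
    ext i j
    exact congrFun (congrFun (key j) i) ()

theorem SuppLE.conj {A B : Matrix n n ℂ} (h : SuppLE A B) (hA : A.PosSemidef) (hB : B.PosSemidef)
    (W : Matrix m n ℂ) : SuppLE (W * A * Wᴴ) (W * B * Wᴴ) := by
  rw [suppLE_iff (hA.mul_mul_conjTranspose_same W) (hB.mul_mul_conjTranspose_same W)]
  intro v hv
  have e : ∀ C : Matrix n n ℂ, vᴴ * (W * C * Wᴴ) * v = (Wᴴ * v)ᴴ * C * (Wᴴ * v) := by
    intro C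
    rw [conjTranspose_mul, conjTranspose_conjTranspose]; simp only [Matrix.mul_assoc]
  rw [e] at hv ⊢
  exact (suppLE_iff hA hB).1 h _ hv

theorem SuppLE.diag_eq_zero {A B : Matrix n n ℂ} (h : SuppLE A B) (hA : A.PosSemidef)
    (hB : B.PosSemidef) {l : n} (hl : (B l l).re = 0) : (A l l).re = 0 := by
  have e : ∀ C : Matrix n n ℂ, ((single l () (1 : ℂ))ᴴ * C * single l () (1 : ℂ)).trace = C l l := by
    intro C
    simp
  have := (suppLE_iff hA hB).1 h (single l () 1)
  rw [e, e] at this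
  exact this hl

theorem SuppLE.refl (A : Matrix n n ℂ) : SuppLE A A := le_refl _

theorem suppLE_zero (A : Matrix n n ℂ) : SuppLE 0 A := suppLE_of_eq_mul (X := 0) (by simp)

end Support

/-! ### The pinching inequality. -/

section Pinching

variable {n o : Type*} [Fintype n] [DecidableEq n] [Fintype o] [DecidableEq o]

theorem sum_sum_ite_sub_mul (a b : o) (z : ℂ) :
    ∑ t : o, ∑ t' : o, ((if a = t then 1 else 0) - (if a = t' then 1 else 0) : ℂ) * z *
      ((if b = t then 1 else 0) - (if b = t' then 1 else 0) : ℂ) =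
      2 * ((Fintype.card o : ℂ) * (if a = b then z else 0) - z) := by
  have h : ∀ t t' : o, ((if a = t then 1 else 0) - (if a = t' then 1 else 0) : ℂ) * z *
      ((if b = t then 1 else 0) - (if b = t' then 1 else 0) : ℂ) =
      (if a = t then if b = t then z else 0 else 0)
        - (if a = t then 1 else 0) * (if b = t' then z else 0)
        - (if b = t then 1 else 0) * (if a = t' then z else 0)
        + (if a = t' then if b = t' then z else 0 else 0) := by
    intro t t'
    split_ifs <;> ring
  simp_rw [h]
  simp only [Finset.sum_add_distrib, Finset.sum_sub_distrib, Finset.sum_const, Finset.sum_ite_eq,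
    Finset.mem_univ, if_true, Finset.card_univ, nsmul_eq_mul, ← Finset.mul_sum, ← Finset.sum_mul]
  by_cases hab : a = b
  · subst hab; simp; ring
  · simp [hab, Ne.symm hab]; ring

/-- With P_t the projection onto the fibre of `c` over t, the difference equals ½ ∑_{t,t'} (P_t -
P_t') A (P_t - P_t')ᴴ, visibly positive. -/
theorem card_mul_pinching_sub_posSemidef {A : Matrix n n ℂ} (hA : A.PosSemidef) (c : n → o) :
    ((Fintype.card o : ℂ) • (of fun i j => if c i = c j then A i j else 0) - A).PosSemidef := by
  have key : ((Fintype.card o : ℂ) • (of fun i j => if c i = c j then A i j else 0) - A) =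
      ((1 / 2 : ℝ) : ℂ) • ∑ t : o, ∑ t' : o,
        (diagonal fun i => ((if c i = t then 1 else 0) - (if c i = t' then 1 else 0) : ℂ)) * A *
        (diagonal fun i => ((if c i = t then 1 else 0) - (if c i = t' then 1 else 0) : ℂ))ᴴ := by
    ext i j
    simp only [Matrix.sub_apply, Matrix.smul_apply, of_apply, smul_eq_mul, Matrix.sum_apply,
      diagonal_conjTranspose, mul_diagonal, diagonal_mul, Pi.star_apply, star_sub,
      apply_ite (star : ℂ → ℂ), star_one, star_zero, sum_sum_ite_sub_mul]
    push_cast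
    ring
  rw [key]
  refine PosSemidef.smul ?_ (by exact_mod_cast (by norm_num : (0:ℝ) ≤ 1 / 2))
  exact posSemidef_sum _ fun t _ => posSemidef_sum _ fun t' _ => hA.mul_mul_conjTranspose_same _

/-- A Hermitian matrix that is block diagonal with respect to the fibres of `c` can be diagonalized
by a unitary with the same block structure. -/
theorem exists_block_diagonalization {P : Matrix n n ℂ} (hP : P.IsHermitian) (c : n → o)
    (hc : ∀ i j, c i ≠ c j → P i j = 0) :
    ∃ (U : Matrix n n ℂ) (d : n → ℝ), Uᴴ * U = 1 ∧ P = U * (diagonal fun i => (d i : ℂ)) * Uᴴ ∧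
      ∀ i j, c i ≠ c j → U i j = 0 := by
  have hb : ∀ t : o, (P.submatrix (Subtype.val : {i // c i = t} → n) Subtype.val).IsHermitian :=
    fun t => hP.submatrix _
  choose V d hV hd using fun t => exists_diagonalization (hb t)
  let e : (Σ t, {i // c i = t}) ≃ n := Equiv.sigmaFiberEquiv c
  have hPe : P.submatrix e e =
      blockDiagonal' fun t => P.submatrix (Subtype.val : {i // c i = t} → n) Subtype.val := by
    ext ⟨t, i, hi⟩ ⟨t', j, hj⟩
    by_cases h : t = t'
    · subst h
      rw [blockDiagonal'_apply_eq]; rfl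
    · rw [blockDiagonal'_apply_ne _ _ _ h]
      exact hc i j (by rwa [hi, hj])
  have hU : (blockDiagonal' V)ᴴ * blockDiagonal' V = 1 := by
    rw [blockDiagonal'_conjTranspose, ← blockDiagonal'_mul]
    simp only [hV]
    exact blockDiagonal'_one
  refine ⟨(blockDiagonal' V).submatrix e.symm e.symm, fun i => d (e.symm i).1 (e.symm i).2,
    ?_, ?_, ?_⟩
  · rw [conjTranspose_submatrix, submatrix_mul_equiv, hU, submatrix_one_equiv]
  · have hD : (diagonal fun i => ((d (e.symm i).1 (e.symm i).2 : ℝ) : ℂ)) =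
        (blockDiagonal' fun t => diagonal fun i => (d t i : ℂ)).submatrix e.symm e.symm := by
      rw [blockDiagonal'_diagonal, submatrix_diagonal_equiv]; rfl
    rw [hD, conjTranspose_submatrix, submatrix_mul_equiv, submatrix_mul_equiv,
      blockDiagonal'_conjTranspose, ← blockDiagonal'_mul, ← blockDiagonal'_mul]
    simp only [← hd]
    rw [← hPe, submatrix_submatrix]
    simp
  · intro i j hij
    have h : blockDiagonal' V ⟨c i, ⟨i, rfl⟩⟩ ⟨c j, ⟨j, rfl⟩⟩ = 0 :=
      blockDiagonal'_apply_ne V _ _ hij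
    exact h

/-- The pinching inequality, in an eigenbasis of the pinched operator. -/
theorem exists_pinching_diagonal {A : Matrix n n ℂ} (hA : A.PosSemidef) (c : n → o) (φ : o → ℝ) :
    ∃ U : Matrix n n ℂ, Uᴴ * U = 1 ∧
      (diagonal fun i => (φ (c i) : ℂ)) = U * (diagonal fun i => (φ (c i) : ℂ)) * Uᴴ ∧
      (U * (diagonal fun i => ((Fintype.card o * ((Uᴴ * A * U) i i).re : ℝ) : ℂ)) * Uᴴ
        - A).PosSemidef := by
  set P : Matrix n n ℂ := of fun i j => if c i = c j then A i j else 0 with hP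
  have hPh : P.IsHermitian := by
    ext i j
    simp only [hP, conjTranspose_apply, of_apply, apply_ite (star : ℂ → ℂ), star_zero]
    rw [hA.1.apply]
    simp only [eq_comm]
  obtain ⟨U, d, hU, hd, hUc⟩ := exists_block_diagonalization hPh c
    (fun i j hij => by simp [hP, hij])
  have hdiag : ∀ l, ((Uᴴ * A * U) l l).re = d l := by
    intro l
    have h1 : (Uᴴ * A * U) l l = (Uᴴ * P * U) l l := by
      simp only [Matrix.mul_apply, Finset.sum_mul]
      refine Finset.sum_congr rfl fun j _ => Finset.sum_congr rfl fun i _ => ?_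
      by_cases hj : c j = c l
      · by_cases hi : c i = c l
        · simp [hP, hi, hj]
        · simp [conjTranspose_apply, hUc i l hi]
      · simp [hUc j l hj]
    rw [h1, hd, unitary_cancel hU]
    simp
  refine ⟨U, hU, ?_, ?_⟩
  -- The diagonal operator is scalar on each block, so it commutes with the block diagonal `U`.
  · have : (diagonal fun i => (φ (c i) : ℂ)) * U = U * (diagonal fun i => (φ (c i) : ℂ)) := by
      ext i j
      rw [diagonal_mul, mul_diagonal]
      by_cases h : c i = c j
      · rw [h, mul_comm]
      · simp [hUc i j h]
    rw [← this, Matrix.mul_assoc, mul_conjTranspose_eq_one hU, Matrix.mul_one]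
  · have : (U * (diagonal fun i => ((Fintype.card o * ((Uᴴ * A * U) i i).re : ℝ) : ℂ)) * Uᴴ) =
        (Fintype.card o : ℂ) • P := by
      rw [hd, ← Matrix.smul_mul, ← Matrix.mul_smul, ← diagonal_smul]
      simp only [hdiag]
      congr 3
      ext i; simp
    rw [this]
    exact card_mul_pinching_sub_posSemidef hA c

/-- The pinching inequality with respect to an operator with eigenvalues `φ (c i)`. -/
theorem exists_pinching {A V : Matrix n n ℂ} (hA : A.PosSemidef) (hV : Vᴴ * V = 1) (c : n → o)
    (φ : o → ℝ) :
    ∃ U : Matrix n n ℂ, Uᴴ * U = 1 ∧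
      V * (diagonal fun i => (φ (c i) : ℂ)) * Vᴴ = U * (diagonal fun i => (φ (c i) : ℂ)) * Uᴴ ∧
      (U * (diagonal fun i => ((Fintype.card o * ((Uᴴ * A * U) i i).re : ℝ) : ℂ)) * Uᴴ
        - A).PosSemidef := by
  obtain ⟨U, hU, h1, h2⟩ := exists_pinching_diagonal (hA.conjTranspose_mul_mul_same V) c φ
  refine ⟨V * U, ?_, ?_, ?_⟩
  · rw [conjTranspose_mul, Matrix.mul_assoc, ← Matrix.mul_assoc Vᴴ, hV, Matrix.one_mul, hU]
  · conv_lhs => rw [h1]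
    rw [conjTranspose_mul]; simp only [Matrix.mul_assoc]
  · have := h2.mul_mul_conjTranspose_same V
    rw [Matrix.mul_sub, Matrix.sub_mul, unitary_cancel' hV] at this
    have e : Uᴴ * (Vᴴ * A * V) * U = (V * U)ᴴ * A * (V * U) := by
      rw [conjTranspose_mul]; simp only [Matrix.mul_assoc]
    rw [e] at this
    convert this using 2
    rw [conjTranspose_mul]; simp only [Matrix.mul_assoc]

end Pinching

/-! ### The trace quantity Q and its comparison with classical sums. -/

section Quantity

variable {m n : Type*} [Fintype m] [DecidableEq m] [Fintype n] [DecidableEq n]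

/-- The trace quantity inside the logarithm of the sandwiched Rényi divergence. -/
def sandwichedQ (α : ℝ) (A B : Matrix n n ℂ) : ℝ :=
  (Matrix.trace (mpow (mpow B ((1 - α) / (2 * α)) * A * mpow B ((1 - α) / (2 * α))) α)).re

theorem sandwichedExponent_ne_zero {α : ℝ} (hα : 1 < α) : (1 - α) / (2 * α) ≠ 0 :=
  div_ne_zero (by linarith) (by positivity)

theorem mpow_posSemidef {A : Matrix n n ℂ} (hA : A.PosSemidef) {s : ℝ} (hs : s ≠ 0) :
    (mpow A s).PosSemidef := by
  obtain ⟨U, d, hU, hd, rfl⟩ := exists_diagonalization_nonneg hA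
  rw [mpow_conj_diagonal hU d hs]
  exact posSemidef_conj_diagonal U fun i => Real.rpow_nonneg (hd i) s

theorem sandwichedQ_nonneg {A B : Matrix n n ℂ} (hA : A.PosSemidef) {α : ℝ} (hα : 1 < α) :
    0 ≤ sandwichedQ α A B :=
  trace_re_nonneg (mpow_posSemidef (mpow_mul_mul_posSemidef hA B _) (by positivity))

theorem mul_cfc_eq_of_mul_eq {B W : Matrix n n ℂ} (hB : B.IsHermitian) (hW : W * B = B)
    {f : ℝ → ℝ} (hf : f 0 = 0) : W * cfc f B = cfc f B := by
  obtain ⟨p, hp⟩ := exists_polynomial_eqOn (B.finite_real_spectrum.insert 0) f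
  obtain ⟨q, rfl⟩ : Polynomial.X ∣ p := by
    rw [Polynomial.X_dvd_iff, Polynomial.coeff_zero_eq_eval_zero, hp 0 (by simp), hf]
  rw [cfc_eq_aeval hB fun x hx => hp x (by simp [hx]), map_mul, Polynomial.aeval_X,
    ← Matrix.mul_assoc, hW]

/-- It is enough that `W` be isometric on the ranges of `A` and `B`; this covers relabellings,
unitaries and the partial isometry of a polar decomposition. -/
theorem sandwichedQ_conj {A B : Matrix n n ℂ} (hA : A.PosSemidef) (hB : B.IsHermitian)
    {W : Matrix m n ℂ} (hWA : Wᴴ * W * A = A) (hWB : Wᴴ * W * B = B) {α : ℝ} (hα : 1 < α) :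
    sandwichedQ α (W * A * Wᴴ) (W * B * Wᴴ) = sandwichedQ α A B := by
  have hα0 : α ≠ 0 := by positivity
  unfold sandwichedQ
  rw [mpow_conj hB hWB (sandwichedExponent_ne_zero hα)]
  set g := (1 - α) / (2 * α)
  have hg : Wᴴ * W * mpow B g = mpow B g :=
    mul_cfc_eq_of_mul_eq hB hWB (Real.zero_rpow (sandwichedExponent_ne_zero hα))
  have hAW : A * (Wᴴ * W) = A := by
    have := congrArg conjTranspose hWA
    rwa [conjTranspose_mul, conjTranspose_mul, conjTranspose_conjTranspose, hA.1.eq] at this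
  have e : W * mpow B g * Wᴴ * (W * A * Wᴴ) * (W * mpow B g * Wᴴ) =
      W * (mpow B g * A * mpow B g) * Wᴴ := by
    calc _ = W * mpow B g * (Wᴴ * W * A) * (Wᴴ * W * mpow B g) * Wᴴ := by
          simp only [Matrix.mul_assoc]
      _ = _ := by rw [hWA, hg]; simp only [Matrix.mul_assoc]
  have hC := (mpow_mul_mul_posSemidef hA B g).1
  have hWC : Wᴴ * W * (mpow B g * A * mpow B g) = mpow B g * A * mpow B g := by
    rw [← Matrix.mul_assoc, ← Matrix.mul_assoc, hg]
  rw [e, mpow_conj hC hWC hα0, trace_mul_comm, ← Matrix.mul_assoc]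
  congr 2
  exact mul_cfc_eq_of_mul_eq hC hWC (Real.zero_rpow hα0)

theorem sandwiched_weight_rpow {b a α : ℝ} (hb : 0 ≤ b) (ha : 0 ≤ a) (hα : 1 < α) :
    (b ^ ((1 - α) / (2 * α)) * a * b ^ ((1 - α) / (2 * α))) ^ α = a ^ α * b ^ (1 - α) := by
  have hg : 0 ≤ b ^ ((1 - α) / (2 * α)) := Real.rpow_nonneg hb _
  rw [mul_comm (b ^ _) a, mul_assoc, Real.mul_rpow ha (by positivity), Real.mul_rpow hg hg,
    ← Real.rpow_mul hb]
  have : (1 - α) / (2 * α) * α = (1 - α) / 2 := by field_simp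
  rw [this, ← sq, ← Real.rpow_natCast, ← Real.rpow_mul hb]
  congr 2
  push_cast; ring

/-- Data processing for a measurement in an eigenbasis of the second argument: there the outer
powers are diagonal, and the claim is Peierls' inequality for the sandwiched operator. -/
theorem sum_diag_rpow_le_sandwichedQ {A U : Matrix n n ℂ} (hA : A.PosSemidef) (hU : Uᴴ * U = 1)
    {b : n → ℝ} (hb : ∀ i, 0 ≤ b i) {α : ℝ} (hα : 1 < α) :
    ∑ l, ((Uᴴ * A * U) l l).re ^ α * b l ^ (1 - α) ≤
      sandwichedQ α A (U * (diagonal fun i => (b i : ℂ)) * Uᴴ) := by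
  refine le_trans (le_of_eq ?_)
    (sum_diag_rpow_le_trace (mpow_mul_mul_posSemidef hA _ ((1 - α) / (2 * α))) hU hα)
  refine Finset.sum_congr rfl fun l _ => ?_
  rw [← sandwiched_weight_rpow (hb l) (diag_re_nonneg (hA.conjTranspose_mul_mul_same U) l) hα,
    mpow_conj_diagonal hU b (sandwichedExponent_ne_zero hα)]
  set D : Matrix n n ℂ := diagonal fun i => ((b i ^ ((1 - α) / (2 * α)) : ℝ) : ℂ) with hD
  have : Uᴴ * (U * D * Uᴴ * A * (U * D * Uᴴ)) * U = D * (Uᴴ * A * U) * D := by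
    calc _ = Uᴴ * U * (D * (Uᴴ * A * U) * D) * (Uᴴ * U) := by simp only [Matrix.mul_assoc]
      _ = _ := by rw [hU, Matrix.one_mul, Matrix.mul_one]
  rw [this, hD, mul_diagonal, diagonal_mul, Complex.re_mul_ofReal, Complex.re_ofReal_mul]

/-- If A is dominated by an operator commuting with the second argument, trace monotonicity reduces
to the commuting case, where Q is a classical sum. Pinching supplies the dominating operator. -/
theorem sandwichedQ_le_sum {A U : Matrix n n ℂ} (hA : A.PosSemidef) (hU : Uᴴ * U = 1)
    {a b : n → ℝ} (ha : ∀ i, 0 ≤ a i) (hb : ∀ i, 0 ≤ b i)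
    (hle : (U * (diagonal fun i => (a i : ℂ)) * Uᴴ - A).PosSemidef) {α : ℝ} (hα : 1 < α) :
    sandwichedQ α A (U * (diagonal fun i => (b i : ℂ)) * Uᴴ) ≤ ∑ l, a l ^ α * b l ^ (1 - α) := by
  set g := (1 - α) / (2 * α) with hg
  set B := U * (diagonal fun i => (b i : ℂ)) * Uᴴ with hB
  have h1 := mpow_mul_mul_posSemidef hle B g
  rw [Matrix.mul_sub, Matrix.sub_mul] at h1
  refine (trace_mpow_mono (mpow_mul_mul_posSemidef hA B g) h1 hα).trans (le_of_eq ?_)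
  rw [hB, mpow_conj_diagonal hU b (sandwichedExponent_ne_zero hα)]
  have : U * (diagonal fun i => ((b i ^ g : ℝ) : ℂ)) * Uᴴ * (U * (diagonal fun i => (a i : ℂ)) * Uᴴ)
      * (U * (diagonal fun i => ((b i ^ g : ℝ) : ℂ)) * Uᴴ) =
      U * (diagonal fun i => ((b i ^ g * a i * b i ^ g : ℝ) : ℂ)) * Uᴴ := by
    calc _ = U * ((diagonal fun i => ((b i ^ g : ℝ) : ℂ)) * (Uᴴ * U) *
          (diagonal fun i => (a i : ℂ)) * (Uᴴ * U) * (diagonal fun i => ((b i ^ g : ℝ) : ℂ))) * Uᴴ := by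
          simp only [Matrix.mul_assoc]
      _ = _ := by
        rw [hU, Matrix.mul_one, Matrix.mul_one, diagonal_mul_diagonal, diagonal_mul_diagonal]
        simp
  rw [this, mpow_conj_diagonal hU _ (by positivity), trace_conj hU, trace_diagonal, Complex.re_sum]
  exact Finset.sum_congr rfl fun l _ => by
    rw [Complex.ofReal_re, sandwiched_weight_rpow (hb l) (ha l) hα]

theorem sandwichedQ_self {B : Matrix n n ℂ} (hB : B.PosSemidef) {α : ℝ} (hα : 1 < α) :
    sandwichedQ α B B ≤ B.trace.re := by
  obtain ⟨U, d, hU, hd, rfl⟩ := exists_diagonalization_nonneg hB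
  refine (sandwichedQ_le_sum hB hU hd hd (by simpa using PosSemidef.zero) hα).trans (le_of_eq ?_)
  rw [trace_conj hU, trace_diagonal, Complex.re_sum]
  refine Finset.sum_congr rfl fun l _ => ?_
  rw [Complex.ofReal_re]
  rcases (hd l).eq_or_lt with h | h
  · rw [← h, Real.zero_rpow (by positivity), zero_mul]
  · rw [← Real.rpow_add h]; simp

theorem sandwichedQ_pos {A B : Matrix n n ℂ} (hA : A.PosSemidef) (hB : B.PosSemidef)
    (h : SuppLE A B) (hA0 : A.trace.re ≠ 0) {α : ℝ} (hα : 1 < α) : 0 < sandwichedQ α A B := by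
  obtain ⟨U, b, hU, hb, rfl⟩ := exists_diagonalization_nonneg hB
  refine lt_of_lt_of_le ?_ (sum_diag_rpow_le_sandwichedQ hA hU hb hα)
  have hd := diag_re_nonneg (hA.conjTranspose_mul_mul_same U)
  obtain ⟨l, hl⟩ : ∃ l, ((Uᴴ * A * U) l l).re ≠ 0 := by
    by_contra! hc
    apply hA0
    have h1 : (Uᴴ * A * U).trace.re = 0 := by
      rw [trace, Complex.re_sum]; exact Finset.sum_eq_zero fun l _ => hc l
    rwa [Matrix.mul_assoc, trace_mul_comm, Matrix.mul_assoc, mul_conjTranspose_eq_one hU,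
      Matrix.mul_one] at h1
  have hbl : b l ≠ 0 := by
    intro h0
    apply hl
    have h2 := h.conj hA hB Uᴴ
    rw [conjTranspose_conjTranspose] at h2
    refine h2.diag_eq_zero (hA.conjTranspose_mul_mul_same U) (hB.conjTranspose_mul_mul_same U) ?_
    rw [unitary_cancel hU]
    simp [h0]
  refine Finset.sum_pos' (fun i _ => mul_nonneg (Real.rpow_nonneg (hd i) _)
    (Real.rpow_nonneg (hb i) _)) ⟨l, Finset.mem_univ _, ?_⟩
  exact mul_pos (Real.rpow_pos_of_pos (lt_of_le_of_ne (hd l) (Ne.symm hl)) _)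
    (Real.rpow_pos_of_pos (lt_of_le_of_ne (hb l) (Ne.symm hbl)) _)

theorem mpow_smul {A : Matrix n n ℂ} (hA : A.PosSemidef) {c : ℝ} (hc : 0 ≤ c) {s : ℝ} (hs : s ≠ 0) :
    mpow ((c : ℂ) • A) s = ((c ^ s : ℝ) : ℂ) • mpow A s := by
  obtain ⟨U, d, hU, hd, rfl⟩ := exists_diagonalization_nonneg hA
  have e : ∀ (r : ℝ) (d' : n → ℝ), (r : ℂ) • (U * (diagonal fun i => (d' i : ℂ)) * Uᴴ) =
      U * (diagonal fun i => ((r * d' i : ℝ) : ℂ)) * Uᴴ := by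
    intro r d'
    rw [← Matrix.smul_mul, ← Matrix.mul_smul, ← diagonal_smul]
    congr 3
    ext i; simp
  rw [e, mpow_conj_diagonal hU _ hs, mpow_conj_diagonal hU _ hs, e]
  simp only [Real.mul_rpow hc (hd _)]

theorem sandwichedQ_smul {A B : Matrix n n ℂ} (hA : A.PosSemidef) (hB : B.PosSemidef) {c d : ℝ}
    (hc : 0 ≤ c) (hd : 0 ≤ d) {α : ℝ} (hα : 1 < α) :
    sandwichedQ α ((c : ℂ) • A) ((d : ℂ) • B) = c ^ α * d ^ (1 - α) * sandwichedQ α A B := by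
  unfold sandwichedQ
  rw [mpow_smul hB hd (sandwichedExponent_ne_zero hα), ← sandwiched_weight_rpow hd hc hα]
  set g := (1 - α) / (2 * α)
  have : ((d ^ g : ℝ) : ℂ) • mpow B g * (c : ℂ) • A * ((d ^ g : ℝ) : ℂ) • mpow B g =
      ((d ^ g * c * d ^ g : ℝ) : ℂ) • (mpow B g * A * mpow B g) := by
    simp only [Matrix.smul_mul, Matrix.mul_smul, smul_smul]
    congr 1
    push_cast; ring
  have h0 : 0 ≤ d ^ g := Real.rpow_nonneg hd g
  rw [this, mpow_smul (mpow_mul_mul_posSemidef hA B g) (by positivity) (by positivity), trace_smul,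
    smul_eq_mul, Complex.re_ofReal_mul]

end Quantity

/-! ### Scalar inequalities and removal of polynomial factors. -/

section Scalar

theorem mul_rpow_mul_mul_rpow {w x y α : ℝ} (hw : 0 ≤ w) (hx : 0 ≤ x) (hy : 0 ≤ y) (hα : 1 < α) :
    (w * x) ^ α * (w * y) ^ (1 - α) = w * (x ^ α * y ^ (1 - α)) := by
  rw [Real.mul_rpow hw hx, Real.mul_rpow hw hy]
  have : w ^ α * w ^ (1 - α) = w := by
    rcases hw.eq_or_lt with h | h
    · rw [← h, Real.zero_rpow (by positivity), zero_mul]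
    · rw [← Real.rpow_add h]; simp
  calc _ = (w ^ α * w ^ (1 - α)) * (x ^ α * y ^ (1 - α)) := by ring
    _ = _ := by rw [this]

/-- Joint convexity and homogeneity of `(x, y) ↦ x ^ α * y ^ (1 - α)`. -/
theorem sum_rpow_mul_sum_rpow_le {ι : Type*} (s : Finset ι) {x y : ι → ℝ} (hx : ∀ i, 0 ≤ x i)
    (hy : ∀ i, 0 ≤ y i) (hxy : ∀ i, y i = 0 → x i = 0) {α : ℝ} (hα : 1 < α) :
    (∑ i ∈ s, x i) ^ α * (∑ i ∈ s, y i) ^ (1 - α) ≤ ∑ i ∈ s, x i ^ α * y i ^ (1 - α) := by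
  have hα0 : 0 < α := by positivity
  -- Weighted Hölder with weights y and values x / y. The hypothesis `hxy` makes y * (x / y) = x
  -- even where y = 0.
  have h := Real.inner_le_weight_mul_Lp_of_nonneg s hα.le y (fun i => x i / y i) hy
    (fun i => div_nonneg (hx i) (hy i))
  have h1 : ∀ i, y i * (x i / y i) = x i := by
    intro i
    by_cases h0 : y i = 0
    · rw [h0, hxy i h0, zero_mul]
    · field_simp
  have h2 : ∀ i, y i * (x i / y i) ^ α = x i ^ α * y i ^ (1 - α) := by
    intro i
    rcases (hy i).eq_or_lt with h0 | h0
    · rw [← h0, hxy i h0.symm, Real.zero_rpow hα0.ne', zero_mul, zero_mul]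
    · rw [Real.div_rpow (hx i) (hy i), Real.rpow_sub h0, Real.rpow_one]; ring
  simp only [h1, h2] at h
  set S := ∑ i ∈ s, y i with hS
  set T := ∑ i ∈ s, x i ^ α * y i ^ (1 - α)
  have hS0 : 0 ≤ S := Finset.sum_nonneg fun i _ => hy i
  have hT0 : 0 ≤ T := Finset.sum_nonneg fun i _ =>
    mul_nonneg (Real.rpow_nonneg (hx i) _) (Real.rpow_nonneg (hy i) _)
  have hX0 : 0 ≤ ∑ i ∈ s, x i := Finset.sum_nonneg fun i _ => hx i
  rcases hS0.eq_or_lt with h0 | h0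
  · rw [← h0, Real.zero_rpow (by linarith), mul_zero]; exact hT0
  have h3 : (∑ i ∈ s, x i) ^ α ≤ S ^ (α - 1) * T := by
    refine (Real.rpow_le_rpow hX0 h hα0.le).trans (le_of_eq ?_)
    rw [Real.mul_rpow (by positivity) (by positivity), ← Real.rpow_mul hS0, ← Real.rpow_mul hT0,
      inv_mul_cancel₀ hα0.ne', Real.rpow_one]
    congr 2
    field_simp
  calc _ ≤ S ^ (α - 1) * T * S ^ (1 - α) := by gcongr
    _ = S ^ (α - 1) * S ^ (1 - α) * T := by ring
    _ = T := by rw [← Real.rpow_add h0]; simp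

/-- If y < x, the geometric factor (y/x)^k beats the polynomial, so the inequality holds for only
finitely many k. -/
theorem le_of_frequently_pow_le {x y α : ℝ} (hy : 0 ≤ y) (D : ℕ)
    (h : ∃ᶠ k : ℕ in Filter.atTop, x ^ k ≤ (((k : ℝ) + 1) ^ D) ^ α * y ^ k) : x ≤ y := by
  by_contra! hlt
  have hx0 : 0 < x := lt_of_le_of_lt hy hlt
  obtain ⟨M, hM⟩ := exists_nat_ge α
  rcases hy.eq_or_lt with h0 | h0
  · obtain ⟨k, hk, hk1⟩ := (h.and_eventually (Filter.eventually_ge_atTop 1)).exists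
    rw [← h0, zero_pow (by omega), mul_zero] at hk
    exact absurd hk (not_le.2 (by positivity))
  set r := y / x with hr
  have hr0 : 0 < r := by positivity
  have hr1 : |r| < 1 := by
    rw [abs_of_pos hr0, hr, div_lt_one hx0]; exact hlt
  have ht := (Filter.tendsto_add_atTop_iff_nat 1).2
    (tendsto_pow_const_mul_const_pow_of_abs_lt_one (D * M) hr1)
  -- The limit is taken at k + 1; being below `r` rather than 1 pays for the extra factor of `r`.
  have hev := ht.eventually (gt_mem_nhds hr0)
  obtain ⟨k, hk, hk1⟩ := (h.and_eventually hev).exists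
  have hb : (((k : ℝ) + 1) ^ D) ^ α ≤ ((k : ℝ) + 1) ^ (D * M) := by
    rw [pow_mul, ← Real.rpow_natCast _ M]
    exact Real.rpow_le_rpow_of_exponent_le (one_le_pow₀ (by linarith [k.cast_nonneg (α := ℝ)])) hM
  have h1 : x ^ k ≤ ((k : ℝ) + 1) ^ (D * M) * y ^ k := hk.trans (by gcongr)
  have h2 : 1 ≤ ((k : ℝ) + 1) ^ (D * M) * r ^ k := by
    rw [hr, div_pow, ← mul_div_assoc, le_div_iff₀ (by positivity), one_mul]; exact h1
  push_cast at hk1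
  rw [pow_succ, ← mul_assoc] at hk1
  nlinarith

end Scalar

/-! ### Tensor powers, polynomial pinching and data processing for measurements. -/

section TensorPower

variable {l m n : Type*} [Fintype l] [DecidableEq l] [Fintype m] [DecidableEq m]
  [Fintype n] [DecidableEq n]

/-- The `k`-fold tensor power of a matrix. -/
def tpow (k : ℕ) (A : Matrix m n ℂ) : Matrix (Fin k → m) (Fin k → n) ℂ :=
  of fun x y => ∏ i, A (x i) (y i)

theorem tpow_apply (k : ℕ) (A : Matrix m n ℂ) (x : Fin k → m) (y : Fin k → n) :
    tpow k A x y = ∏ i, A (x i) (y i) := rfl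

theorem prod_sum_eq_sum_prod {k : ℕ} (f : Fin k → n → ℂ) :
    ∏ i, ∑ j, f i j = ∑ x : Fin k → n, ∏ i, f i (x i) := by
  rw [Finset.prod_univ_sum, Fintype.piFinset_univ]

theorem tpow_mul (k : ℕ) (A : Matrix l m ℂ) (B : Matrix m n ℂ) :
    tpow k (A * B) = tpow k A * tpow k B := by
  ext x y
  simp only [tpow_apply, Matrix.mul_apply, prod_sum_eq_sum_prod, Finset.prod_mul_distrib]

theorem tpow_conjTranspose (k : ℕ) (A : Matrix m n ℂ) : tpow k Aᴴ = (tpow k A)ᴴ := by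
  ext x y
  simp [tpow_apply, conjTranspose_apply]

theorem tpow_diagonal (k : ℕ) (d : n → ℂ) :
    tpow k (diagonal d) = diagonal fun x => ∏ i, d (x i) := by
  ext x y
  rw [tpow_apply]
  by_cases h : x = y
  · subst h; simp
  · obtain ⟨i, hi⟩ := Function.ne_iff.1 h
    rw [diagonal_apply_ne _ h]
    exact Finset.prod_eq_zero (Finset.mem_univ i) (diagonal_apply_ne _ hi)

theorem tpow_one (k : ℕ) : tpow k (1 : Matrix n n ℂ) = 1 := by
  rw [← diagonal_one, tpow_diagonal]; simp

theorem trace_tpow (k : ℕ) (A : Matrix n n ℂ) : (tpow k A).trace = A.trace ^ k := by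
  simp only [trace, diag_apply, tpow_apply]
  rw [← prod_sum_eq_sum_prod (fun _ j => A j j)]
  simp

theorem tpow_unitary (k : ℕ) {U : Matrix m n ℂ} (hU : Uᴴ * U = 1) :
    (tpow k U)ᴴ * tpow k U = 1 := by
  rw [← tpow_conjTranspose, ← tpow_mul, hU, tpow_one]

theorem tpow_conj_diagonal (k : ℕ) (U : Matrix n n ℂ) (d : n → ℝ) :
    tpow k (U * (diagonal fun i => (d i : ℂ)) * Uᴴ) =
      tpow k U * (diagonal fun x : Fin k → n => ((∏ i, d (x i) : ℝ) : ℂ)) * (tpow k U)ᴴ := by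
  rw [tpow_mul, tpow_mul, tpow_diagonal, tpow_conjTranspose]
  push_cast
  rfl

theorem tpow_posSemidef (k : ℕ) {A : Matrix n n ℂ} (hA : A.PosSemidef) : (tpow k A).PosSemidef := by
  obtain ⟨U, d, hU, hd, rfl⟩ := exists_diagonalization_nonneg hA
  rw [tpow_conj_diagonal]
  exact posSemidef_conj_diagonal _ fun x => Finset.prod_nonneg fun i _ => hd _

theorem mpow_tpow (k : ℕ) {A : Matrix n n ℂ} (hA : A.PosSemidef) {s : ℝ} (hs : s ≠ 0) :
    mpow (tpow k A) s = tpow k (mpow A s) := by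
  obtain ⟨U, d, hU, hd, rfl⟩ := exists_diagonalization_nonneg hA
  rw [tpow_conj_diagonal, mpow_conj_diagonal hU d hs, tpow_conj_diagonal,
    mpow_conj_diagonal (tpow_unitary k hU) _ hs]
  simp only [Real.finsetProd_rpow _ _ (fun i _ => hd _)]

theorem sandwichedQ_tpow (k : ℕ) {A B : Matrix n n ℂ} (hA : A.PosSemidef) (hB : B.PosSemidef)
    {α : ℝ} (hα : 1 < α) : sandwichedQ α (tpow k A) (tpow k B) = sandwichedQ α A B ^ k := by
  unfold sandwichedQ
  rw [mpow_tpow k hB (sandwichedExponent_ne_zero hα), ← tpow_mul, ← tpow_mul]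
  have hC := mpow_mul_mul_posSemidef hA B ((1 - α) / (2 * α))
  rw [mpow_tpow k hC (by positivity), trace_tpow]
  have h := (mpow_posSemidef hC (s := α) (by positivity)).trace_nonneg
  set t := (mpow (mpow B ((1 - α) / (2 * α)) * A * mpow B ((1 - α) / (2 * α))) α).trace
  have ht : t = (t.re : ℂ) := Complex.ext rfl (Complex.le_def.1 h).2.symm
  rw [ht, ← Complex.ofReal_pow, Complex.ofReal_re, Complex.ofReal_re]

/-- The pinching inequality for tensor powers, with a polynomial constant. -/
theorem exists_pinching_tpow (k : ℕ) {A B : Matrix n n ℂ} (hA : A.PosSemidef) (hB : B.PosSemidef) :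
    ∃ (U : Matrix (Fin k → n) (Fin k → n) ℂ) (b : (Fin k → n) → ℝ), Uᴴ * U = 1 ∧ (∀ x, 0 ≤ b x) ∧
      tpow k B = U * (diagonal fun x => (b x : ℂ)) * Uᴴ ∧
      (U * (diagonal fun x => ((((k : ℝ) + 1) ^ Fintype.card n *
        ((Uᴴ * tpow k A * U) x x).re : ℝ) : ℂ)) * Uᴴ - tpow k A).PosSemidef := by
  obtain ⟨V, β, hV, hβ, rfl⟩ := exists_diagonalization_nonneg hB
  -- The type of x: an eigenvalue of the tensor power depends only on how often each index occurs.
  -- Each count lies in 0, …, k, whence at most (k + 1) ^ card n classes.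
  let c : (Fin k → n) → n → Fin (k + 1) := fun x j =>
    ⟨(Finset.univ.filter fun i => x i = j).card, Nat.lt_succ_of_le ((Finset.card_le_univ _).trans
      (Fintype.card_fin k).le)⟩
  let φ : (n → Fin (k + 1)) → ℝ := fun f => ∏ j, β j ^ (f j : ℕ)
  have hφ : ∀ x : Fin k → n, ∏ i, β (x i) = φ (c x) := by
    intro x
    rw [← Finset.prod_fiberwise' Finset.univ x β]
    simp [φ, c]
  obtain ⟨U, hU, h1, h2⟩ := exists_pinching (tpow_posSemidef k hA) (tpow_unitary k hV) c φ
  refine ⟨U, fun x => φ (c x), hU, fun x => Finset.prod_nonneg fun j _ => pow_nonneg (hβ j) _,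
    ?_, ?_⟩
  · rw [tpow_conj_diagonal, ← h1]
    simp only [hφ]
  · simpa using h2

/-- Monotonicity of the sandwiched quantity under a pinched measurement, up to a constant. -/
theorem sum_diag_rpow_le_of_pinching {A U : Matrix n n ℂ} (hA : A.PosSemidef) (hU : Uᴴ * U = 1)
    {a b : n → ℝ} (ha : ∀ i, 0 ≤ a i) (hb : ∀ i, 0 ≤ b i) (hab : ∀ i, b i = 0 → a i = 0)
    (hle : (U * (diagonal fun i => (a i : ℂ)) * Uᴴ - A).PosSemidef) {α : ℝ} (hα : 1 < α) :
    ∑ j, (A j j).re ^ α * ((U * (diagonal fun i => (b i : ℂ)) * Uᴴ) j j).re ^ (1 - α) ≤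
      ∑ l, a l ^ α * b l ^ (1 - α) := by
  have key : ∀ j, (A j j).re ^ α * ((U * (diagonal fun i => (b i : ℂ)) * Uᴴ) j j).re ^ (1 - α) ≤
      ∑ l, ‖U j l‖ ^ 2 * (a l ^ α * b l ^ (1 - α)) := by
    intro j
    have h1 := diag_re_nonneg hle j
    rw [Matrix.sub_apply, Complex.sub_re, conj_diagonal_diag_re] at h1
    have h2 := diag_re_nonneg hA j
    rw [conj_diagonal_diag_re]
    have h3 : 0 ≤ ∑ i, ‖U j i‖ ^ 2 * b i :=
      Finset.sum_nonneg fun i _ => mul_nonneg (by positivity) (hb i)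
    -- Both measured operators are bounded or given by sums with the same weights, so joint
    -- convexity and homogeneity apply.
    calc _ ≤ (∑ i, ‖U j i‖ ^ 2 * a i) ^ α * (∑ i, ‖U j i‖ ^ 2 * b i) ^ (1 - α) := by
          gcongr
          linarith
      _ ≤ ∑ i, (‖U j i‖ ^ 2 * a i) ^ α * (‖U j i‖ ^ 2 * b i) ^ (1 - α) := by
          refine sum_rpow_mul_sum_rpow_le _ (fun i => mul_nonneg (by positivity) (ha i))
            (fun i => mul_nonneg (by positivity) (hb i)) (fun i hi => ?_) hα
          rcases mul_eq_zero.1 hi with h | h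
          · rw [h, zero_mul]
          · rw [hab i h, mul_zero]
      _ = _ := Finset.sum_congr rfl fun i _ =>
          mul_rpow_mul_mul_rpow (by positivity) (ha i) (hb i) hα
  refine (Finset.sum_le_sum fun j _ => key j).trans (le_of_eq ?_)
  rw [Finset.sum_comm]
  exact Finset.sum_congr rfl fun l _ => by rw [← Finset.sum_mul, sum_norm_sq_col hU, one_mul]

theorem SuppLE.tpow (k : ℕ) {A B : Matrix n n ℂ} (h : SuppLE A B) :
    SuppLE (tpow k A) (tpow k B) := by
  obtain ⟨X, rfl⟩ := h.exists_eq_mul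
  exact suppLE_of_eq_mul (tpow_mul k B X)

theorem SuppLE.eigenbasis_eq_zero {A U : Matrix n n ℂ} {b : n → ℝ} (hU : Uᴴ * U = 1)
    (hb : ∀ i, 0 ≤ b i) (hA : A.PosSemidef)
    (h : SuppLE A (U * (diagonal fun i => (b i : ℂ)) * Uᴴ)) {i : n} (hi : b i = 0) :
    ((Uᴴ * A * U) i i).re = 0 := by
  have hB := posSemidef_conj_diagonal U hb
  have h2 := h.conj hA hB Uᴴ
  rw [conjTranspose_conjTranspose] at h2
  refine h2.diag_eq_zero (hA.conjTranspose_mul_mul_same U) (hB.conjTranspose_mul_mul_same U) ?_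
  rw [unitary_cancel hU]
  simp [hi]

theorem mul_rpow_sum {ι : Type*} (t : Finset ι) {s : ℝ} (hs : 0 ≤ s) {a b : ι → ℝ}
    (ha : ∀ i, 0 ≤ a i) (α β : ℝ) :
    ∑ i ∈ t, (s * a i) ^ α * b i ^ β = s ^ α * ∑ i ∈ t, a i ^ α * b i ^ β := by
  rw [Finset.mul_sum]
  exact Finset.sum_congr rfl fun i _ => by rw [Real.mul_rpow hs (ha i), mul_assoc]

/-- Monotonicity of the sandwiched quantity under the measurement in the standard basis. -/
theorem sum_diag_rpow_le_of_suppLE {A B : Matrix n n ℂ} (hA : A.PosSemidef) (hB : B.PosSemidef)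
    (h : SuppLE A B) {α : ℝ} (hα : 1 < α) :
    ∑ j, (A j j).re ^ α * (B j j).re ^ (1 - α) ≤ sandwichedQ α A B := by
  -- Both sides are multiplicative under tensor powers, so a bound with a polynomial factor for
  -- every k suffices.
  refine le_of_frequently_pow_le (α := α) (sandwichedQ_nonneg hA hα) (Fintype.card n)
    (Filter.Eventually.frequently (Filter.Eventually.of_forall fun k => ?_))
  obtain ⟨U, b, hU, hb, hBk, hpin⟩ := exists_pinching_tpow k hA hB
  have hAk := tpow_posSemidef k hA
  have hd := diag_re_nonneg (hAk.conjTranspose_mul_mul_same U)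
  have hs : (0 : ℝ) ≤ ((k : ℝ) + 1) ^ Fintype.card n := by positivity
  have hre : ∀ {C : Matrix n n ℂ}, C.PosSemidef → ∀ x : Fin k → n,
      (QDiv.tpow k C x x).re = ∏ i, (C (x i) (x i)).re := by
    intro C hC x
    have : ∀ j, C j j = ((C j j).re : ℂ) := fun j =>
      Complex.ext rfl (Complex.le_def.1 (hC.diag_nonneg (i := j))).2.symm
    rw [tpow_apply, Finset.prod_congr rfl fun i _ => this (x i), ← Complex.ofReal_prod,
      Complex.ofReal_re]
  have h1 : (∑ j, (A j j).re ^ α * (B j j).re ^ (1 - α)) ^ k =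
      ∑ x, (QDiv.tpow k A x x).re ^ α * (QDiv.tpow k B x x).re ^ (1 - α) := by
    have : (∑ j, (A j j).re ^ α * (B j j).re ^ (1 - α)) ^ k =
        ∏ _i : Fin k, ∑ j, (A j j).re ^ α * (B j j).re ^ (1 - α) := by simp
    rw [this, Finset.prod_univ_sum, Fintype.piFinset_univ]
    refine Finset.sum_congr rfl fun x _ => ?_
    rw [hre hA, hre hB, Finset.prod_mul_distrib,
      Real.finsetProd_rpow _ _ (fun i _ => diag_re_nonneg hA _),
      Real.finsetProd_rpow _ _ (fun i _ => diag_re_nonneg hB _)]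
  have hsupp := h.tpow k
  rw [hBk] at hsupp
  rw [h1, hBk]
  refine (sum_diag_rpow_le_of_pinching hAk hU (fun i => mul_nonneg hs (hd i)) hb (fun i hi => ?_)
    hpin hα).trans ?_
  · rw [hsupp.eigenbasis_eq_zero hU hb hAk hi, mul_zero]
  rw [mul_rpow_sum _ hs hd, ← sandwichedQ_tpow k hA hB hα, hBk]
  gcongr
  exact sum_diag_rpow_le_sandwichedQ hAk hU hb hα

/-- Monotonicity of the sandwiched quantity under a rank-one projective measurement. -/
theorem sum_conj_diag_rpow_le_of_suppLE {A B U : Matrix n n ℂ} (hA : A.PosSemidef)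
    (hB : B.PosSemidef) (h : SuppLE A B) (hU : Uᴴ * U = 1) {α : ℝ} (hα : 1 < α) :
    ∑ j, ((Uᴴ * A * U) j j).re ^ α * ((Uᴴ * B * U) j j).re ^ (1 - α) ≤ sandwichedQ α A B := by
  have hU' := mul_conjTranspose_eq_one hU
  have h1 := sandwichedQ_conj (W := Uᴴ) hA hB.1
    (by rw [conjTranspose_conjTranspose, hU', Matrix.one_mul])
    (by rw [conjTranspose_conjTranspose, hU', Matrix.one_mul]) hα
  have h2 := h.conj hA hB Uᴴ
  rw [conjTranspose_conjTranspose] at h1 h2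
  rw [← h1]
  exact sum_diag_rpow_le_of_suppLE (hA.conjTranspose_mul_mul_same U)
    (hB.conjTranspose_mul_mul_same U) h2 hα

end TensorPower

/-! ### The chain rule up to a polynomial factor. -/

section Chain

variable {m n p q : Type*} [Fintype m] [DecidableEq m] [Fintype n] [DecidableEq n]
  [Fintype p] [DecidableEq p] [Fintype q] [DecidableEq q]

/-- A vector killed by B has tensor power killed by that of B, hence by that of A. The
constant-index entries of A^{⊗k} v^{⊗k} are k-th powers of the entries of A v. -/
theorem SuppLE.of_tpow {k : ℕ} (hk : k ≠ 0) {A B : Matrix n n ℂ} (hA : A.PosSemidef)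
    (hB : B.PosSemidef) (h : SuppLE (QDiv.tpow k A) (QDiv.tpow k B)) : SuppLE A B := by
  rw [suppLE_iff hA hB]
  intro v hv
  rw [← mul_eq_zero_iff_trace hB] at hv
  rw [← mul_eq_zero_iff_trace hA]
  have h1 : QDiv.tpow k B * QDiv.tpow k v = 0 := by
    rw [← tpow_mul, hv]
    ext x y
    simp [tpow_apply, hk]
  have h2 := mul_eq_zero_of_suppLE (tpow_posSemidef k hA).1 (tpow_posSemidef k hB).1 h h1
  rw [← tpow_mul] at h2
  ext i u
  have h3 := congrFun (congrFun h2 fun _ => i) fun _ => u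
  rw [tpow_apply, Finset.prod_const] at h3
  exact eq_zero_of_pow_eq_zero h3

theorem conj_diagonal_eq_sum (U : Matrix m n ℂ) (a : n → ℝ) :
    U * (diagonal fun i => (a i : ℂ)) * Uᴴ =
      ∑ x, (a x : ℂ) • (U.submatrix id (fun _ : Unit => x) *
        (U.submatrix id (fun _ : Unit => x))ᴴ) := by
  ext i j
  rw [conj_diagonal_apply, Matrix.sum_apply]
  refine Finset.sum_congr rfl fun x _ => ?_
  simp [Matrix.mul_apply]
  ring

theorem conj_sum_smul_diag_re {ι : Type*} [Fintype ι] (F : Matrix n m ℂ) (a : ι → ℝ)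
    (D : ι → Matrix n n ℂ) (j : m) :
    ((Fᴴ * (∑ x, (a x : ℂ) • D x) * F) j j).re = ∑ x, a x * ((Fᴴ * D x * F) j j).re := by
  rw [Matrix.mul_sum, Matrix.sum_mul, Matrix.sum_apply, Complex.re_sum]
  refine Finset.sum_congr rfl fun x _ => ?_
  rw [Matrix.mul_smul, Matrix.smul_mul, Matrix.smul_apply, smul_eq_mul, Complex.re_ofReal_mul]

theorem trace_unit_re (C : Matrix Unit Unit ℂ) : C.trace.re = (C () ()).re := by
  simp [trace]

theorem conj_diag_re_mono {A B : Matrix n n ℂ} (h : (B - A).PosSemidef) (F : Matrix n m ℂ) (j : m) :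
    ((Fᴴ * A * F) j j).re ≤ ((Fᴴ * B * F) j j).re := by
  have := diag_re_nonneg (h.conjTranspose_mul_mul_same F) j
  rw [Matrix.mul_sub, Matrix.sub_mul, Matrix.sub_apply, Complex.sub_re] at this
  linarith

/-- If the form of ∑ b_i B_i vanishes at v, then for each i either b_i = 0, so a_i = 0, or B_i and
hence A_i vanishes at v. The operator bound on S then forces its form to vanish too. -/
theorem suppLE_of_le_sum {ι : Type*} [Fintype ι] {S : Matrix n n ℂ} (hS : S.PosSemidef)
    {a b : ι → ℝ} (hb : ∀ i, 0 ≤ b i) (hab : ∀ i, b i = 0 → a i = 0)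
    {A B : ι → Matrix n n ℂ} (hA : ∀ i, (A i).PosSemidef) (hB : ∀ i, (B i).PosSemidef)
    (hAB : ∀ i, SuppLE (A i) (B i)) (hle : ((∑ i, (a i : ℂ) • A i) - S).PosSemidef) :
    SuppLE S (∑ i, (b i : ℂ) • B i) := by
  have hT : (∑ i, (b i : ℂ) • B i).PosSemidef :=
    posSemidef_sum _ fun i _ => (hB i).smul (by exact_mod_cast hb i)
  rw [suppLE_iff hS hT]
  intro v hv
  rw [trace_unit_re, conj_sum_smul_diag_re, Finset.sum_eq_zero_iff_of_nonneg (fun i _ =>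
    mul_nonneg (hb i) (diag_re_nonneg ((hB i).conjTranspose_mul_mul_same v) ()))] at hv
  have h1 := conj_diag_re_mono hle v ()
  rw [conj_sum_smul_diag_re, Finset.sum_eq_zero] at h1
  · rw [trace_unit_re]
    exact le_antisymm h1 (diag_re_nonneg (hS.conjTranspose_mul_mul_same v) ())
  · intro i hi
    rcases mul_eq_zero.1 (hv i hi) with h | h
    · rw [hab i h, zero_mul]
    · rw [← trace_unit_re] at h ⊢
      rw [(suppLE_iff (hA i) (hB i)).1 (hAB i) v h, mul_zero]

/-- The chain rule for two positive maps acting on tensor powers, up to a polynomial factor. -/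
theorem sandwichedQ_pow_le_of_positive_maps {k : ℕ} (hk : k ≠ 0)
    (Φ Ψ : Matrix (Fin k → p) (Fin k → p) ℂ →ₗ[ℂ] Matrix (Fin k → q) (Fin k → q) ℂ)
    (hΦ : ∀ C, C.PosSemidef → (Φ C).PosSemidef) (hΨ : ∀ C, C.PosSemidef → (Ψ C).PosSemidef)
    {α E : ℝ} (hα : 1 < α)
    (hE : ∀ v : Matrix (Fin k → p) Unit ℂ, vᴴ * v = 1 →
      SuppLE (Φ (v * vᴴ)) (Ψ (v * vᴴ)) ∧ sandwichedQ α (Φ (v * vᴴ)) (Ψ (v * vᴴ)) ≤ E)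
    {ρ σ : Matrix p p ℂ} (hρ : ρ.PosSemidef) (hσ : σ.PosSemidef) (h : SuppLE ρ σ)
    {ρ' σ' : Matrix q q ℂ} (hρ' : ρ'.PosSemidef) (hσ' : σ'.PosSemidef)
    (hΦρ : Φ (tpow k ρ) = tpow k ρ') (hΨσ : Ψ (tpow k σ) = tpow k σ') :
    SuppLE ρ' σ' ∧ sandwichedQ α ρ' σ' ^ k ≤
      (((k : ℝ) + 1) ^ (Fintype.card p + Fintype.card q)) ^ α * (sandwichedQ α ρ σ ^ k * E) := by
  have hρk := tpow_posSemidef k hρ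
  have hSk := tpow_posSemidef k hρ'
  have hTk := tpow_posSemidef k hσ'
  -- Input pinching: the columns u_x of `U` diagonalize σ^{⊗k} and the operator dominating ρ^{⊗k},
  -- so the maps need only be known on the u_x u_xᴴ.
  obtain ⟨U, b, hU, hb, hσU, hpin⟩ := exists_pinching_tpow k hρ hσ
  -- Output pinching: in the eigenbasis `F` of σ'^{⊗k}, Q of the outputs is a classical sum up to
  -- `s' ^ α`.
  obtain ⟨F, t, hF, ht, hTF, hpin'⟩ := exists_pinching_tpow k hρ' hσ'
  set s : ℝ := ((k : ℝ) + 1) ^ Fintype.card p with hs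
  set s' : ℝ := ((k : ℝ) + 1) ^ Fintype.card q with hs'
  have hs0 : 0 ≤ s := by positivity
  have hs0' : 0 ≤ s' := by positivity
  set a : (Fin k → p) → ℝ := fun x => s * ((Uᴴ * tpow k ρ * U) x x).re with ha_def
  have hd := diag_re_nonneg (hρk.conjTranspose_mul_mul_same U)
  have ha : ∀ x, 0 ≤ a x := fun x => mul_nonneg hs0 (hd x)
  have hsupp := h.tpow k
  rw [hσU] at hsupp
  have hab : ∀ x, b x = 0 → a x = 0 := fun x hx => by
    rw [ha_def]
    simp only
    rw [hsupp.eigenbasis_eq_zero hU hb hρk hx, mul_zero]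
  set u : (Fin k → p) → Matrix (Fin k → p) Unit ℂ := fun x => U.submatrix id fun _ => x with hu_def
  have hu : ∀ x, (u x)ᴴ * u x = 1 := by
    intro x
    ext i j
    have := congrFun (congrFun hU x) x
    rw [one_apply_eq] at this
    rw [← one_apply_eq (α := ℂ) i] at this
    exact this
  have hP : ∀ x, (u x * (u x)ᴴ).PosSemidef := fun x => posSemidef_self_mul_conjTranspose _
  have hN : ∀ x, (Φ (u x * (u x)ᴴ)).PosSemidef := fun x => hΦ _ (hP x)
  have hM : ∀ x, (Ψ (u x * (u x)ᴴ)).PosSemidef := fun x => hΨ _ (hP x)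
  have hT : tpow k σ' = ∑ x, (b x : ℂ) • Ψ (u x * (u x)ᴴ) := by
    rw [← hΨσ, hσU, conj_diagonal_eq_sum, map_sum]
    simp only [map_smul, hu_def]
  have hS : ((∑ x, (a x : ℂ) • Φ (u x * (u x)ᴴ)) - tpow k ρ').PosSemidef := by
    have := hΦ _ hpin
    rw [map_sub, hΦρ, conj_diagonal_eq_sum, map_sum] at this
    simpa only [map_smul, hu_def, ha_def] using this
  refine ⟨SuppLE.of_tpow hk hρ' hσ' ?_, ?_⟩
  · rw [hT]
    exact suppLE_of_le_sum hSk hb hab hN hM (fun x => (hE _ (hu x)).1) hS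
  have hd' := diag_re_nonneg (hSk.conjTranspose_mul_mul_same F)
  have htF : ∀ j, t j = ∑ x, b x * ((Fᴴ * Ψ (u x * (u x)ᴴ) * F) j j).re := by
    intro j
    rw [← conj_sum_smul_diag_re, ← hT, hTF, unitary_cancel hF]
    simp
  have hNF := fun x => diag_re_nonneg ((hN x).conjTranspose_mul_mul_same F)
  have hMF := fun x => diag_re_nonneg ((hM x).conjTranspose_mul_mul_same F)
  have key : ∀ j, ((Fᴴ * tpow k ρ' * F) j j).re ^ α * t j ^ (1 - α) ≤
      ∑ x, a x ^ α * b x ^ (1 - α) * (((Fᴴ * Φ (u x * (u x)ᴴ) * F) j j).re ^ α *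
        ((Fᴴ * Ψ (u x * (u x)ᴴ) * F) j j).re ^ (1 - α)) := by
    intro j
    have h1 := conj_diag_re_mono hS F j
    rw [conj_sum_smul_diag_re] at h1
    have htj := ht j
    calc _ ≤ (∑ x, a x * ((Fᴴ * Φ (u x * (u x)ᴴ) * F) j j).re) ^ α * t j ^ (1 - α) := by
          have := hd' j
          gcongr
      _ ≤ _ := by
        rw [htF]
        refine (sum_rpow_mul_sum_rpow_le _ (fun x => mul_nonneg (ha x) (hNF x j))
          (fun x => mul_nonneg (hb x) (hMF x j)) (fun x hx => ?_) hα).trans (le_of_eq ?_)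
        · rcases mul_eq_zero.1 hx with h0 | h0
          · rw [hab x h0, zero_mul]
          · have h2 := (hE _ (hu x)).1.conj (hN x) (hM x) Fᴴ
            rw [conjTranspose_conjTranspose] at h2
            rw [h2.diag_eq_zero ((hN x).conjTranspose_mul_mul_same F)
              ((hM x).conjTranspose_mul_mul_same F) h0, mul_zero]
        · refine Finset.sum_congr rfl fun x _ => ?_
          rw [Real.mul_rpow (ha x) (hNF x j), Real.mul_rpow (hb x) (hMF x j)]
          ring
  have hE0 : ∀ x, 0 ≤ a x ^ α * b x ^ (1 - α) := fun x =>
    mul_nonneg (Real.rpow_nonneg (ha x) _) (Real.rpow_nonneg (hb x) _)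
  have hsum : ∑ x, a x ^ α * b x ^ (1 - α) ≤ s ^ α * sandwichedQ α ρ σ ^ k := by
    rw [mul_rpow_sum _ hs0 hd, ← sandwichedQ_tpow k hρ hσ hα, hσU]
    gcongr
    exact sum_diag_rpow_le_sandwichedQ hρk hU hb hα
  -- With no index x, `hE` gives no information on the sign of `E`; both quantities vanish in that
  -- case.
  rcases isEmpty_or_nonempty (Fin k → p) with hemp | ⟨⟨x₀⟩⟩
  · have h0 : sandwichedQ α ρ' σ' ^ k ≤ 0 := by
      rw [← sandwichedQ_tpow k hρ' hσ' hα, hTF]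
      refine (sandwichedQ_le_sum hSk hF (fun j => mul_nonneg hs0' (hd' j)) ht hpin' hα).trans ?_
      rw [mul_rpow_sum _ hs0' hd']
      have : ∑ j, ((Fᴴ * tpow k ρ' * F) j j).re ^ α * t j ^ (1 - α) ≤ 0 :=
        (Finset.sum_le_sum fun j _ => key j).trans (by simp)
      exact mul_nonpos_of_nonneg_of_nonpos (by positivity) this
    have h1 : sandwichedQ α ρ σ ^ k = 0 := by
      rw [← sandwichedQ_tpow k hρ hσ hα]
      simp [sandwichedQ, trace]
    rwa [h1, zero_mul, mul_zero]
  have hEpos : 0 ≤ E := (sandwichedQ_nonneg (hN x₀) hα).trans (hE _ (hu x₀)).2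
  calc sandwichedQ α ρ' σ' ^ k ≤
        ∑ j, (s' * ((Fᴴ * tpow k ρ' * F) j j).re) ^ α * t j ^ (1 - α) := by
        rw [← sandwichedQ_tpow k hρ' hσ' hα, hTF]
        exact sandwichedQ_le_sum hSk hF (fun j => mul_nonneg hs0' (hd' j)) ht hpin' hα
    _ = s' ^ α * ∑ j, ((Fᴴ * tpow k ρ' * F) j j).re ^ α * t j ^ (1 - α) :=
        mul_rpow_sum _ hs0' hd' _ _
    _ ≤ s' ^ α * ∑ x, a x ^ α * b x ^ (1 - α) * E := by
        gcongr
        refine (Finset.sum_le_sum fun j _ => key j).trans ?_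
        rw [Finset.sum_comm]
        refine Finset.sum_le_sum fun x _ => ?_
        rw [← Finset.mul_sum]
        exact mul_le_mul_of_nonneg_left ((sum_conj_diag_rpow_le_of_suppLE (hN x) (hM x)
          (hE _ (hu x)).1 hF hα).trans (hE _ (hu x)).2) (hE0 x)
    _ ≤ s' ^ α * (s ^ α * sandwichedQ α ρ σ ^ k * E) := by
        rw [← Finset.sum_mul]
        gcongr
    _ = _ := by
        rw [pow_add, Real.mul_rpow hs0 hs0']
        ring

end Chain

/-! ### Invariance under relabelling of the basis. -/

section Reindex

variable {m n : Type*} [Fintype m] [DecidableEq m] [Fintype n] [DecidableEq n]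

theorem submatrix_eq_conj (A : Matrix n n ℂ) (e : m ≃ n) :
    A.submatrix e e = (1 : Matrix n n ℂ).submatrix e id * A *
      ((1 : Matrix n n ℂ).submatrix e id)ᴴ := by
  ext i j
  simp [Matrix.mul_apply, Matrix.one_apply]

theorem SuppLE.submatrix {A B : Matrix n n ℂ} (h : SuppLE A B) (hA : A.PosSemidef)
    (hB : B.PosSemidef) (e : m ≃ n) : SuppLE (A.submatrix e e) (B.submatrix e e) := by
  rw [submatrix_eq_conj, submatrix_eq_conj B]
  exact h.conj hA hB _

theorem sandwichedQ_submatrix {A B : Matrix n n ℂ} (hA : A.PosSemidef) (hB : B.PosSemidef)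
    (e : m ≃ n) {α : ℝ} (hα : 1 < α) :
    sandwichedQ α (A.submatrix e e) (B.submatrix e e) = sandwichedQ α A B := by
  have hW : ((1 : Matrix n n ℂ).submatrix e id)ᴴ * (1 : Matrix n n ℂ).submatrix e id = 1 := by
    rw [conjTranspose_submatrix, conjTranspose_one, submatrix_mul_equiv]
    simp
  rw [submatrix_eq_conj, submatrix_eq_conj B]
  exact sandwichedQ_conj hA hB.1 (by rw [hW, Matrix.one_mul]) (by rw [hW, Matrix.one_mul]) hα

end Reindex

/-! ### Ampliations, tensor powers of maps and Choi operators. -/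

section Maps

variable {X Y R S : Type*} [Fintype X] [DecidableEq X] [Fintype Y] [DecidableEq Y]
  [Fintype R] [DecidableEq R] [Fintype S] [DecidableEq S]

theorem linearMap_apply_eq_sum (N : Matrix X X ℂ →ₗ[ℂ] Matrix Y Y ℂ) (A : Matrix X X ℂ) (y y' : Y) :
    N A y y' = ∑ x, ∑ x', A x x' * N (single x x' 1) y y' := by
  conv_lhs => rw [matrix_eq_sum_single A]
  rw [map_sum, Matrix.sum_apply]
  refine Finset.sum_congr rfl fun x _ => ?_
  rw [map_sum, Matrix.sum_apply]
  refine Finset.sum_congr rfl fun x' _ => ?_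
  have : single x x' (A x x') = A x x' • single x x' (1 : ℂ) := by simp
  rw [this, map_smul, Matrix.smul_apply, smul_eq_mul]

theorem ampliation_apply_eq_sum (N : Matrix X X ℂ →ₗ[ℂ] Matrix Y Y ℂ)
    (A : Matrix (R × X) (R × X) ℂ) (r r' : R) (y y' : Y) :
    ampliation R N A (r, y) (r', y') =
      ∑ x, ∑ x', A (r, x) (r', x') * N (single x x' 1) y y' := by
  simp only [ampliation, of_apply]
  rw [linearMap_apply_eq_sum]
  rfl

/-- The ampliation as a linear map. -/
def ampliationLM (R : Type*) [Fintype R] [DecidableEq R] (N : Matrix X X ℂ →ₗ[ℂ] Matrix Y Y ℂ) :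
    Matrix (R × X) (R × X) ℂ →ₗ[ℂ] Matrix (R × Y) (R × Y) ℂ where
  toFun := ampliation R N
  map_add' A B := by
    ext ⟨r, y⟩ ⟨r', y'⟩
    simp [ampliation_apply_eq_sum, add_mul, Finset.sum_add_distrib]
  map_smul' c A := by
    ext ⟨r, y⟩ ⟨r', y'⟩
    simp [ampliation_apply_eq_sum, mul_assoc, Finset.mul_sum]

theorem ampliation_submatrix (N : Matrix X X ℂ →ₗ[ℂ] Matrix Y Y ℂ) (A : Matrix (R × X) (R × X) ℂ)
    (e : S ≃ R) :
    ampliation S N (A.submatrix (e.prodCongr (Equiv.refl X)) (e.prodCongr (Equiv.refl X))) =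
      (ampliation R N A).submatrix (e.prodCongr (Equiv.refl Y)) (e.prodCongr (Equiv.refl Y)) :=
  rfl

/-- Complete positivity and amortized bounds are stated for references `Fin k`; this transports them
to an arbitrary finite reference. -/
theorem ampliation_eq_submatrix (N : Matrix X X ℂ →ₗ[ℂ] Matrix Y Y ℂ)
    (A : Matrix (R × X) (R × X) ℂ) (e : R ≃ S) :
    ampliation R N A =
      (ampliation S N (A.submatrix (e.symm.prodCongr (Equiv.refl X))
        (e.symm.prodCongr (Equiv.refl X)))).submatrix
        (e.prodCongr (Equiv.refl Y)) (e.prodCongr (Equiv.refl Y)) := by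
  rw [ampliation_submatrix, submatrix_submatrix]
  ext ⟨r, y⟩ ⟨r', y'⟩
  simp

theorem IsCompletelyPositive.ampliation_posSemidef {N : Matrix X X ℂ →ₗ[ℂ] Matrix Y Y ℂ}
    (hN : IsCompletelyPositive N) {A : Matrix (R × X) (R × X) ℂ} (hA : A.PosSemidef) :
    (ampliation R N A).PosSemidef := by
  rw [ampliation_eq_submatrix N A (Fintype.equivFin R)]
  exact (hN _ _ (hA.submatrix _)).submatrix _

/-- Splitting off the first tensor factor. -/
def consProdEquiv (R X : Type*) (k : ℕ) : (R × (Fin k → X)) × X ≃ R × (Fin (k + 1) → X) where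
  toFun p := (p.1.1, Fin.cons p.2 p.1.2)
  invFun p := ((p.1, Fin.tail p.2), p.2 0)
  left_inv p := by simp
  right_inv p := by simp

theorem sum_fin_succ {k : ℕ} (f : (Fin (k + 1) → X) → ℂ) :
    ∑ x, f x = ∑ x : Fin k → X, ∑ x₀ : X, f (Fin.cons x₀ x) := by
  rw [Finset.sum_comm, ← Fintype.sum_prod_type' (f := fun x₀ x => f (Fin.cons x₀ x))]
  exact (Fintype.sum_equiv (Fin.consEquiv fun _ => X) _ _ fun _ => rfl).symm

/-- The exchange of the last two factors of a triple product. -/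
def prodExchange (R S T : Type*) : (R × S) × T ≃ (R × T) × S where
  toFun p := ((p.1.1, p.2), p.1.2)
  invFun p := ((p.1.1, p.2), p.1.2)
  left_inv _ := rfl
  right_inv _ := rfl

/-- N acts on the first factor with reference R ⊗ X^{⊗k}; then N^{⊗k} acts on the others with
reference R ⊗ Y. The inductions on k rest on this factorization. -/
theorem ampliation_tensorPower_succ (k : ℕ) (N : Matrix X X ℂ →ₗ[ℂ] Matrix Y Y ℂ)
    (A : Matrix (R × (Fin (k + 1) → X)) (R × (Fin (k + 1) → X)) ℂ) :
    ampliation R (tensorPower (k + 1) N) A =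
      (ampliation (R × Y) (tensorPower k N)
        ((ampliation (R × (Fin k → X)) N
          (A.submatrix (consProdEquiv R X k) (consProdEquiv R X k))).submatrix
            (prodExchange R Y (Fin k → X)) (prodExchange R Y (Fin k → X)))).submatrix
        ((consProdEquiv R Y k).symm.trans (prodExchange R (Fin k → Y) Y))
        ((consProdEquiv R Y k).symm.trans (prodExchange R (Fin k → Y) Y)) := by
  ext ⟨r, y⟩ ⟨r', y'⟩
  have h : ∀ (x x' : Fin k → X),
      ampliation (R × (Fin k → X)) N (A.submatrix (consProdEquiv R X k) (consProdEquiv R X k))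
        ((r, x), y 0) ((r', x'), y' 0) = ∑ x₀, ∑ x₀', A (r, Fin.cons x₀ x) (r', Fin.cons x₀' x') *
          N (single x₀ x₀' 1) (y 0) (y' 0) := fun x x' => ampliation_apply_eq_sum N _ _ _ _ _
  have hR : ∀ B : Matrix ((R × Y) × (Fin k → X)) ((R × Y) × (Fin k → X)) ℂ,
      ((ampliation (R × Y) (tensorPower k N) B).submatrix
        ((consProdEquiv R Y k).symm.trans (prodExchange R (Fin k → Y) Y))
        ((consProdEquiv R Y k).symm.trans (prodExchange R (Fin k → Y) Y))) (r, y) (r', y') =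
      ∑ x, ∑ x', B ((r, y 0), x) ((r', y' 0), x') *
        ∏ i, N (single (x i) (x' i) 1) (y i.succ) (y' i.succ) := fun B => rfl
  rw [hR]
  have hL : ampliation R (tensorPower (k + 1) N) A (r, y) (r', y') =
      ∑ x, ∑ x', A (r, x) (r', x') * ∏ i, N (single (x i) (x' i) 1) (y i) (y' i) := rfl
  rw [hL, sum_fin_succ]
  refine Finset.sum_congr rfl fun x _ => ?_
  simp_rw [sum_fin_succ (X := X)]
  rw [Finset.sum_comm]
  refine Finset.sum_congr rfl fun x' _ => ?_
  have h2 : ((ampliation (R × (Fin k → X)) N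
      (A.submatrix (consProdEquiv R X k) (consProdEquiv R X k))).submatrix
        (prodExchange R Y (Fin k → X)) (prodExchange R Y (Fin k → X))) ((r, y 0), x)
          ((r', y' 0), x') = ∑ x₀, ∑ x₀', A (r, Fin.cons x₀ x) (r', Fin.cons x₀' x') *
          N (single x₀ x₀' 1) (y 0) (y' 0) := h x x'
  rw [h2, Finset.sum_mul]
  refine Finset.sum_congr rfl fun x₀ _ => ?_
  rw [Finset.sum_mul]
  refine Finset.sum_congr rfl fun x₀' _ => ?_
  rw [Fin.prod_univ_succ]
  simp [mul_assoc]

theorem ampliation_tensorPower_zero (N : Matrix X X ℂ →ₗ[ℂ] Matrix Y Y ℂ)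
    (A : Matrix (R × (Fin 0 → X)) (R × (Fin 0 → X)) ℂ) :
    ampliation R (tensorPower 0 N) A =
      A.submatrix ((Equiv.refl R).prodCongr (Equiv.ofUnique (Fin 0 → Y) (Fin 0 → X)))
        ((Equiv.refl R).prodCongr (Equiv.ofUnique (Fin 0 → Y) (Fin 0 → X))) := by
  ext ⟨r, y⟩ ⟨r', y'⟩
  have hL : ampliation R (tensorPower 0 N) A (r, y) (r', y') =
      ∑ x, ∑ x', A (r, x) (r', x') * ∏ i, N (single (x i) (x' i) 1) (y i) (y' i) := rfl
  rw [hL]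
  rw [Fintype.sum_unique, Fintype.sum_unique, Finset.univ_eq_empty, Finset.prod_empty, mul_one]
  rfl

theorem IsCompletelyPositive.tensorPower {N : Matrix X X ℂ →ₗ[ℂ] Matrix Y Y ℂ}
    (hN : IsCompletelyPositive N) (k : ℕ) : IsCompletelyPositive (QDiv.tensorPower k N) := by
  induction k with
  | zero =>
    intro r A hA
    rw [ampliation_tensorPower_zero]
    exact hA.submatrix _
  | succ k ih =>
    intro r A hA
    rw [ampliation_tensorPower_succ]
    exact (ih.ampliation_posSemidef ((hN.ampliation_posSemidef (hA.submatrix _)).submatrix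
      _)).submatrix _

theorem choi_apply (N : Matrix X X ℂ →ₗ[ℂ] Matrix Y Y ℂ) (x x' : X) (y y' : Y) :
    choi N (x, y) (x', y') = N (single x x' 1) y y' := by
  simp only [choi, Matrix.sum_apply, kroneckerMap_apply]
  rw [Finset.sum_eq_single x, Finset.sum_eq_single x']
  · simp
  · intro b _ hb; simp [single, hb]
  · simp
  · intro b _ hb; simp [single, hb]
  · simp

/-- The image of a pure state in terms of the Choi operator. -/
theorem ampliation_pure (N : Matrix X X ℂ →ₗ[ℂ] Matrix Y Y ℂ) (v : Matrix (R × X) Unit ℂ) :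
    ampliation R N (v * vᴴ) =
      ((of fun r x => v (r, x) () : Matrix R X ℂ) ⊗ₖ (1 : Matrix Y Y ℂ)) * choi N *
        ((of fun r x => v (r, x) () : Matrix R X ℂ) ⊗ₖ (1 : Matrix Y Y ℂ))ᴴ := by
  ext ⟨r, y⟩ ⟨r', y'⟩
  rw [ampliation_apply_eq_sum]
  simp only [Matrix.mul_apply, Fintype.sum_prod_type, kroneckerMap_apply, conjTranspose_apply,
    choi_apply, of_apply, Matrix.one_apply, Finset.univ_unique, Finset.sum_singleton]
  simp only [mul_ite, mul_one, mul_zero, ite_mul, zero_mul, Finset.sum_ite_eq, Finset.mem_univ,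
    if_true, apply_ite (star : ℂ → ℂ), star_zero, Finset.sum_mul]
  rw [Finset.sum_comm]
  refine Finset.sum_congr rfl fun x _ => Finset.sum_congr rfl fun x' _ => ?_
  simp only [PUnit.default_eq_unit]
  ring

/-- The Choi operator is the image of the unnormalized maximally entangled state, whose coefficient
matrix is the identity. -/
theorem choi_posSemidef {N : Matrix X X ℂ →ₗ[ℂ] Matrix Y Y ℂ} (hN : IsCompletelyPositive N) :
    (choi N).PosSemidef := by
  have h := ampliation_pure N (of fun (p : X × X) (_ : Unit) => (1 : Matrix X X ℂ) p.1 p.2)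
  have e : (of fun r x => (of fun (p : X × X) (_ : Unit) => (1 : Matrix X X ℂ) p.1 p.2) (r, x) () :
      Matrix X X ℂ) = 1 := rfl
  rw [e, one_kronecker_one, conjTranspose_one, Matrix.mul_one, Matrix.one_mul] at h
  rw [← h]
  exact hN.ampliation_posSemidef (posSemidef_self_mul_conjTranspose _)

end Maps

/-! ### Extended-real divergence bounds in multiplicative form. -/

section Divergence

variable {m n : Type*} [Fintype m] [DecidableEq m] [Fintype n] [DecidableEq n]

theorem coe_mul_le_coe_iff {a c : ℝ} (ha : 0 < a) (x : EReal) :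
    (a : EReal) * x ≤ c ↔ x ≤ ((c / a : ℝ) : EReal) := by
  induction x using EReal.rec with
  | bot => simp [EReal.coe_mul_bot_of_pos ha]
  | coe x => rw [← EReal.coe_mul, EReal.coe_le_coe_iff, EReal.coe_le_coe_iff, le_div_iff₀ ha, mul_comm]
  | top =>
    rw [EReal.coe_mul_top_of_pos ha, top_le_iff, top_le_iff]
    simp [EReal.coe_ne_top]

theorem sandwiched_of_not_suppLE {A B : Matrix n n ℂ} (h : ¬ SuppLE A B) (α : ℝ) :
    sandwiched α A B = ⊤ := if_neg h

theorem sandwiched_of_suppLE {A B : Matrix n n ℂ} (h : SuppLE A B) (α : ℝ) :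
    sandwiched α A B = ((1 / (α - 1) : ℝ) : EReal) * elog (sandwichedQ α A B) := if_pos h

theorem elog_le_coe_iff (x c : ℝ) : elog x ≤ c ↔ x ≤ 2 ^ c := by
  unfold elog
  split_ifs with h
  · exact ⟨fun _ => h.trans (by positivity), fun _ => bot_le⟩
  · rw [EReal.coe_le_coe_iff, Real.logb_le_iff_le_rpow one_lt_two (not_le.1 h)]

theorem sandwiched_le_coe_iff {A B : Matrix n n ℂ} {α : ℝ} (hα : 1 < α) (c : ℝ) :
    sandwiched α A B ≤ c ↔ SuppLE A B ∧ sandwichedQ α A B ≤ 2 ^ ((α - 1) * c) := by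
  by_cases h : SuppLE A B
  · rw [sandwiched_of_suppLE h, coe_mul_le_coe_iff (by simpa using hα), elog_le_coe_iff,
      div_div_eq_mul_div, div_one, mul_comm]
    simp [h]
  · rw [sandwiched_of_not_suppLE h, top_le_iff]
    simp [h]

/-- Positivity of Q makes the subtracted divergence a real number when supports are nested, so it
can be moved across. Otherwise it is `⊤`, the difference is `⊥`, and both sides hold trivially. -/
theorem sandwiched_sub_le_coe_iff {A B : Matrix n n ℂ} {A' B' : Matrix m m ℂ} {α : ℝ} (hα : 1 < α)
    (hpos : SuppLE A B → 0 < sandwichedQ α A B) (c : ℝ) :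
    sandwiched α A' B' - sandwiched α A B ≤ c ↔
      (SuppLE A B → SuppLE A' B' ∧ sandwichedQ α A' B' ≤ 2 ^ ((α - 1) * c) * sandwichedQ α A B) := by
  by_cases h : SuppLE A B
  · have h0 := hpos h
    have h1 : sandwiched α A B = ((1 / (α - 1) * Real.logb 2 (sandwichedQ α A B) : ℝ) : EReal) := by
      rw [sandwiched_of_suppLE h, elog, if_neg (not_le.2 h0), EReal.coe_mul]
    have h2 : (2 : ℝ) ^ ((α - 1) * (c + 1 / (α - 1) * Real.logb 2 (sandwichedQ α A B))) =
        2 ^ ((α - 1) * c) * sandwichedQ α A B := by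
      have : α - 1 ≠ 0 := by linarith
      rw [mul_add, ← mul_assoc, mul_one_div_cancel this, one_mul, Real.rpow_add two_pos,
        Real.rpow_logb two_pos (by norm_num) h0]
    rw [h1, EReal.sub_le_iff_le_add (Or.inl (EReal.coe_ne_bot _)) (Or.inl (EReal.coe_ne_top _)),
      ← EReal.coe_add, sandwiched_le_coe_iff hα, h2]
    simp [h]
  · rw [sandwiched_of_not_suppLE h, sub_eq_add_neg, EReal.neg_top, EReal.add_bot]
    simp [h]

theorem SuppLE.smul {A B : Matrix n n ℂ} (h : SuppLE A B) (c : ℂ) {d : ℂ} (hd : d ≠ 0) :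
    SuppLE (c • A) (d • B) := by
  obtain ⟨X, rfl⟩ := h.exists_eq_mul
  refine suppLE_of_eq_mul (X := (c / d) • X) ?_
  rw [Matrix.smul_mul, Matrix.mul_smul, smul_smul, mul_div_cancel₀ _ hd]

theorem sandwichedQ_zero_left (B : Matrix n n ℂ) {α : ℝ} (hα : 1 < α) : sandwichedQ α 0 B = 0 := by
  have h := mpow_smul (PosSemidef.zero (n := n) (R := ℂ)) le_rfl (s := α) (by positivity)
  rw [Real.zero_rpow (by positivity), smul_zero, Complex.ofReal_zero, zero_smul] at h
  simp [sandwichedQ, h]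

end Divergence

/-! ### Pure inputs with an arbitrary reference. -/

section PureStates

variable {X Y R : Type*} [Fintype X] [DecidableEq X] [Fintype Y] [DecidableEq Y]
  [Fintype R] [DecidableEq R]

/-- The polar decomposition `V = W * (Vᴴ * V) ^ (1 / 2)` with a partial isometry `W`. -/
theorem exists_polar (V : Matrix R X ℂ) :
    ∃ W : Matrix R X ℂ, V = W * mpow (Vᴴ * V) (1 / 2) ∧
      Wᴴ * W * mpow (Vᴴ * V) (1 / 2) = mpow (Vᴴ * V) (1 / 2) := by
  obtain ⟨U, d, hU, hd, hω⟩ := exists_diagonalization_nonneg (posSemidef_conjTranspose_mul_self V)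
  rw [hω, mpow_conj_diagonal hU d (by norm_num)]
  set H : Matrix X X ℂ := diagonal fun i => ((d i ^ (1 / 2 : ℝ) : ℝ) : ℂ) with hH
  set G : Matrix X X ℂ := diagonal fun i => (((d i ^ (1 / 2 : ℝ))⁻¹ : ℝ) : ℂ) with hG
  set D : Matrix X X ℂ := diagonal fun i => (d i : ℂ) with hD
  have hs : ∀ i, d i = d i ^ (1 / 2 : ℝ) * d i ^ (1 / 2 : ℝ) := fun i => by
    rw [← Real.sqrt_eq_rpow, Real.mul_self_sqrt (hd i)]
  have hDGH : D * G * H = D := by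
    simp only [hD, hG, hH, diagonal_mul_diagonal]
    congr 1; ext i
    norm_cast
    by_cases h0 : d i ^ (1 / 2 : ℝ) = 0
    · rw [h0, hs i, h0]; simp
    · rw [mul_assoc, inv_mul_cancel₀ h0, mul_one]
  have hGDGH : G * D * G * H = H := by
    simp only [hD, hG, hH, diagonal_mul_diagonal]
    congr 1; ext i
    norm_cast
    by_cases h0 : d i ^ (1 / 2 : ℝ) = 0
    · rw [h0]; simp
    · nth_rewrite 2 [hs i]
      field_simp
  have hGh : Gᴴ = G := (isHermitian_diagonal_ofReal _).eq
  have hcancel : ∀ P Q : Matrix X X ℂ, U * P * Uᴴ * (U * Q * Uᴴ) = U * (P * Q) * Uᴴ := by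
    intro P Q
    calc _ = U * P * (Uᴴ * U) * Q * Uᴴ := by simp only [Matrix.mul_assoc]
      _ = _ := by rw [hU, Matrix.mul_one]; simp only [Matrix.mul_assoc]
  refine ⟨V * (U * G * Uᴴ), ?_, ?_⟩
  · rw [Matrix.mul_assoc, hcancel]
    -- `U * (G * H) * Uᴴ` is the support projection of `Vᴴ * V`; since that product has the same
    -- kernel as `V`, the complement is killed by `V`.
    have h1 : (Vᴴ * V) * (1 - U * (G * H) * Uᴴ) = 0 := by
      rw [hω, Matrix.mul_sub, Matrix.mul_one, hcancel, ← Matrix.mul_assoc D, hDGH, sub_self]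
    have h2 : (V * (1 - U * (G * H) * Uᴴ))ᴴ * (V * (1 - U * (G * H) * Uᴴ)) = 0 := by
      rw [conjTranspose_mul, Matrix.mul_assoc, ← Matrix.mul_assoc Vᴴ, h1, Matrix.mul_zero]
    have h3 := trace_conjTranspose_mul_self_eq_zero_iff.1 (by rw [h2, trace_zero])
    rw [Matrix.mul_sub, Matrix.mul_one, sub_eq_zero] at h3
    exact h3
  · have : (V * (U * G * Uᴴ))ᴴ * (V * (U * G * Uᴴ)) = U * G * Uᴴ * (Vᴴ * V) * (U * G * Uᴴ) := by
      rw [conjTranspose_mul, conjTranspose_mul, conjTranspose_mul, conjTranspose_conjTranspose, hGh]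
      simp only [Matrix.mul_assoc]
    rw [this, hω, hcancel, hcancel, hcancel, hGDGH]

theorem kronecker_one_mul {l m n : Type*} [Fintype m] [Fintype n] (A : Matrix l m ℂ)
    (B : Matrix m n ℂ) : (A * B) ⊗ₖ (1 : Matrix Y Y ℂ) = A ⊗ₖ (1 : Matrix Y Y ℂ) * B ⊗ₖ (1 : Matrix Y Y ℂ) := by
  rw [← mul_kronecker_mul, Matrix.one_mul]

theorem conjTranspose_kronecker_one {l m : Type*} (A : Matrix l m ℂ) :
    (A ⊗ₖ (1 : Matrix Y Y ℂ))ᴴ = Aᴴ ⊗ₖ 1 := by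
  rw [conjTranspose_kronecker, conjTranspose_one]

/-- The channel divergence bounds the divergence of the outputs on every pure input, with an
arbitrary reference system. -/
theorem sandwiched_ampliation_pure_le {N M : Matrix X X ℂ →ₗ[ℂ] Matrix Y Y ℂ}
    (hN : IsCompletelyPositive N) (hM : IsCompletelyPositive M) {α c : ℝ} (hα : 1 < α)
    (hc : channelDiv α N M ≤ c) (v : Matrix (R × X) Unit ℂ) (hv : vᴴ * v = 1) :
    SuppLE (ampliation R N (v * vᴴ)) (ampliation R M (v * vᴴ)) ∧
      sandwichedQ α (ampliation R N (v * vᴴ)) (ampliation R M (v * vᴴ)) ≤ 2 ^ ((α - 1) * c) := by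
  -- The coefficient matrix of v; `Vᴴ * V` is the transpose of the reduced state on X and plays the
  -- role of ω.
  set V : Matrix R X ℂ := of fun r x => v (r, x) () with hV
  have hdens : IsDensity (Vᴴ * V) := by
    refine ⟨posSemidef_conjTranspose_mul_self V, ?_⟩
    have h1 : (vᴴ * v) () () = 1 := by rw [hv]; rfl
    rw [← h1]
    simp only [trace, diag_apply, Matrix.mul_apply, conjTranspose_apply, hV, of_apply,
      Fintype.sum_prod_type]
    rw [Finset.sum_comm]
  obtain ⟨W, hW, hWH⟩ := exists_polar V
  set H := mpow (Vᴴ * V) (1 / 2)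
  have hH : Hᴴ = H := (isHermitian_mpow _ _).eq
  have h1 := (iSup₂_le_iff.1 hc) _ hdens
  rw [sandwiched_le_coe_iff hα] at h1
  have hWk : (W ⊗ₖ (1 : Matrix Y Y ℂ))ᴴ * W ⊗ₖ (1 : Matrix Y Y ℂ) * H ⊗ₖ (1 : Matrix Y Y ℂ) =
      H ⊗ₖ (1 : Matrix Y Y ℂ) := by
    rw [conjTranspose_kronecker_one, ← kronecker_one_mul, ← kronecker_one_mul, hWH]
  have key : ∀ L : Matrix X X ℂ →ₗ[ℂ] Matrix Y Y ℂ, ampliation R L (v * vᴴ) =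
      W ⊗ₖ (1 : Matrix Y Y ℂ) * (H ⊗ₖ (1 : Matrix Y Y ℂ) * choi L * H ⊗ₖ (1 : Matrix Y Y ℂ)) *
        (W ⊗ₖ (1 : Matrix Y Y ℂ))ᴴ := by
    intro L
    rw [ampliation_pure, ← hV, hW, kronecker_one_mul, conjTranspose_mul,
      conjTranspose_kronecker_one H, hH]
    simp only [Matrix.mul_assoc]
  have hpsd : ∀ {L : Matrix X X ℂ →ₗ[ℂ] Matrix Y Y ℂ}, IsCompletelyPositive L →
      (H ⊗ₖ (1 : Matrix Y Y ℂ) * choi L * H ⊗ₖ (1 : Matrix Y Y ℂ)).PosSemidef := by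
    intro L hL
    have := (choi_posSemidef hL).mul_mul_conjTranspose_same (H ⊗ₖ (1 : Matrix Y Y ℂ))
    rwa [conjTranspose_kronecker_one, hH] at this
  have hfix : ∀ L : Matrix X X ℂ →ₗ[ℂ] Matrix Y Y ℂ,
      (W ⊗ₖ (1 : Matrix Y Y ℂ))ᴴ * W ⊗ₖ (1 : Matrix Y Y ℂ) *
        (H ⊗ₖ (1 : Matrix Y Y ℂ) * choi L * H ⊗ₖ (1 : Matrix Y Y ℂ)) =
      H ⊗ₖ (1 : Matrix Y Y ℂ) * choi L * H ⊗ₖ (1 : Matrix Y Y ℂ) := by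
    intro L
    rw [← Matrix.mul_assoc, ← Matrix.mul_assoc, hWk]
  rw [key N, key M, sandwichedQ_conj (hpsd hN) (hpsd hM).1 (hfix N) (hfix M) hα]
  exact ⟨h1.1.conj (hpsd hN) (hpsd hM) _, h1.2⟩

end PureStates

/-! ### The amortized divergence bounds every normalized term. -/

section Amortization

variable {X Y R : Type*} [Fintype X] [DecidableEq X] [Fintype Y] [DecidableEq Y]
  [Fintype R] [DecidableEq R]

/-- The multiplicative form of an upper bound on the amortized divergence. -/
def IsAmortizedBound (α K : ℝ) (N M : Matrix X X ℂ →ₗ[ℂ] Matrix Y Y ℂ) : Prop :=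
  ∀ (r : ℕ) (ρ σ : Matrix (Fin r × X) (Fin r × X) ℂ), ρ.PosSemidef → σ.PosSemidef → SuppLE ρ σ →
    SuppLE (ampliation (Fin r) N ρ) (ampliation (Fin r) M σ) ∧
      sandwichedQ α (ampliation (Fin r) N ρ) (ampliation (Fin r) M σ) ≤ K * sandwichedQ α ρ σ

variable {N M : Matrix X X ℂ →ₗ[ℂ] Matrix Y Y ℂ}

theorem IsAmortizedBound.ampliation {α K : ℝ} (h : IsAmortizedBound α K N M) (hα : 1 < α)
    (hN : IsCompletelyPositive N) (hM : IsCompletelyPositive M)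
    {ρ σ : Matrix (R × X) (R × X) ℂ} (hρ : ρ.PosSemidef) (hσ : σ.PosSemidef) (hs : SuppLE ρ σ) :
    SuppLE (ampliation R N ρ) (ampliation R M σ) ∧
      sandwichedQ α (ampliation R N ρ) (ampliation R M σ) ≤ K * sandwichedQ α ρ σ := by
  let e := Fintype.equivFin R
  let f := e.symm.prodCongr (Equiv.refl X)
  obtain ⟨h1, h2⟩ := h _ _ _ (hρ.submatrix f) (hσ.submatrix f) (hs.submatrix hρ hσ f)
  have hN' := hN _ _ (hρ.submatrix f)
  have hM' := hM _ _ (hσ.submatrix f)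
  rw [ampliation_eq_submatrix N ρ e, ampliation_eq_submatrix M σ e,
    sandwichedQ_submatrix hN' hM' _ hα]
  rw [sandwichedQ_submatrix hρ hσ _ hα] at h2
  exact ⟨h1.submatrix hN' hM' _, h2⟩

/-- Each use of the maps contributes one factor K. The output of one use is the input of the next,
which is why the bound must hold for unnormalized operators. -/
theorem IsAmortizedBound.tensorPower {α K : ℝ} (h : IsAmortizedBound α K N M) (hα : 1 < α)
    (hK : 0 ≤ K) (hN : IsCompletelyPositive N) (hM : IsCompletelyPositive M) (k : ℕ) :
    IsAmortizedBound α (K ^ k) (tensorPower k N) (tensorPower k M) := by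
  induction k with
  | zero =>
    intro r ρ σ hρ hσ hs
    rw [ampliation_tensorPower_zero, ampliation_tensorPower_zero, sandwichedQ_submatrix hρ hσ _ hα]
    exact ⟨hs.submatrix hρ hσ _, by simp⟩
  | succ k ih =>
    intro r ρ σ hρ hσ hs
    let f := consProdEquiv (Fin r) X k
    let g := prodExchange (Fin r) Y (Fin k → X)
    have hN' := hN.ampliation_posSemidef (hρ.submatrix f)
    have hM' := hM.ampliation_posSemidef (hσ.submatrix f)
    have hN'' := (hN.tensorPower k).ampliation_posSemidef (hN'.submatrix g)
    have hM'' := (hM.tensorPower k).ampliation_posSemidef (hM'.submatrix g)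
    obtain ⟨h1, h2⟩ := h.ampliation hα hN hM (hρ.submatrix f) (hσ.submatrix f)
      (hs.submatrix hρ hσ f)
    obtain ⟨h3, h4⟩ := ih.ampliation hα (hN.tensorPower k) (hM.tensorPower k) (hN'.submatrix g)
      (hM'.submatrix g) (h1.submatrix hN' hM' g)
    rw [sandwichedQ_submatrix hρ hσ _ hα] at h2
    rw [sandwichedQ_submatrix hN' hM' _ hα] at h4
    rw [ampliation_tensorPower_succ, ampliation_tensorPower_succ,
      sandwichedQ_submatrix hN'' hM'' _ hα]
    refine ⟨h3.submatrix hN'' hM'' _, h4.trans ?_⟩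
    rw [pow_succ, mul_assoc]
    gcongr

theorem ofReal_trace_re {A : Matrix R R ℂ} (hA : A.PosSemidef) : (A.trace.re : ℂ) = A.trace :=
  Complex.ext rfl (Complex.le_def.1 hA.trace_nonneg).2

theorem exists_density_smul {A : Matrix R R ℂ} (hA : A.PosSemidef) (h0 : A ≠ 0) :
    ∃ (t : ℝ) (B : Matrix R R ℂ), 0 < t ∧ IsDensity B ∧ A = (t : ℂ) • B := by
  have ht0 : A.trace.re ≠ 0 := by
    intro h
    apply h0
    rw [← hA.trace_eq_zero_iff, ← ofReal_trace_re hA, h, Complex.ofReal_zero]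
  have ht : 0 < A.trace.re := lt_of_le_of_ne (trace_re_nonneg hA) (Ne.symm ht0)
  refine ⟨A.trace.re, ((A.trace.re⁻¹ : ℝ) : ℂ) • A, ht, ⟨?_, ?_⟩, ?_⟩
  · exact hA.smul (by exact_mod_cast (inv_nonneg.2 ht.le))
  · rw [trace_smul, ← ofReal_trace_re hA, smul_eq_mul, ← Complex.ofReal_mul, Complex.ofReal_re,
      inv_mul_cancel₀ ht0, Complex.ofReal_one]
  · rw [smul_smul, ← Complex.ofReal_mul, mul_inv_cancel₀ ht0, Complex.ofReal_one, one_smul]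

theorem ampliation_smul (N : Matrix X X ℂ →ₗ[ℂ] Matrix Y Y ℂ) (c : ℂ)
    (A : Matrix (R × X) (R × X) ℂ) : ampliation R N (c • A) = c • ampliation R N A :=
  map_smul (ampliationLM R N) c A

theorem ampliation_zero (N : Matrix X X ℂ →ₗ[ℂ] Matrix Y Y ℂ) :
    ampliation R N (0 : Matrix (R × X) (R × X) ℂ) = 0 :=
  map_zero (ampliationLM R N)

theorem IsDensity.sandwichedQ_pos {ρ σ : Matrix R R ℂ} (hρ : IsDensity ρ) (hσ : IsDensity σ) {α : ℝ}
    (hα : 1 < α) (h : SuppLE ρ σ) : 0 < sandwichedQ α ρ σ :=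
  QDiv.sandwichedQ_pos hρ.1 hσ.1 h (by rw [hρ.2]; simp) hα

/-- Scaling ρ by t and σ by u multiplies the input and output quantities by the same t^α u^(1-α), so
the bound passes from density operators to all positive ones. Zero operators are treated apart. -/
theorem isAmortizedBound_of_amortizedDiv_le {α c : ℝ} (hα : 1 < α) (hN : IsCompletelyPositive N)
    (hM : IsCompletelyPositive M) (hc : amortizedDiv α N M ≤ c) :
    IsAmortizedBound α (2 ^ ((α - 1) * c)) N M := by
  intro r ρ σ hρ hσ hs
  by_cases hρ0 : ρ = 0
  · rw [hρ0, ampliation_zero, sandwichedQ_zero_left _ hα, sandwichedQ_zero_left _ hα, mul_zero]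
    exact ⟨suppLE_zero _, le_rfl⟩
  have hσ0 : σ ≠ 0 := by
    rintro rfl
    obtain ⟨Z, hZ⟩ := hs.exists_eq_mul
    exact hρ0 (by rw [hZ, Matrix.zero_mul])
  obtain ⟨t, ρ₁, ht, hρ₁, rfl⟩ := exists_density_smul hρ hρ0
  obtain ⟨u, σ₁, hu, hσ₁, rfl⟩ := exists_density_smul hσ hσ0
  have ht0 : (t : ℂ) ≠ 0 := by exact_mod_cast ht.ne'
  have hu0 : (u : ℂ) ≠ 0 := by exact_mod_cast hu.ne'
  have hs₁ : SuppLE ρ₁ σ₁ := by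
    have := hs.smul (t : ℂ)⁻¹ (inv_ne_zero hu0)
    rwa [smul_smul, smul_smul, inv_mul_cancel₀ ht0, inv_mul_cancel₀ hu0, one_smul, one_smul] at this
  have h1 : sandwiched α (ampliation (Fin r) N ρ₁) (ampliation (Fin r) M σ₁) -
      sandwiched α ρ₁ σ₁ ≤ c := by
    refine le_trans ?_ hc
    exact le_iSup_of_le r (le_iSup_of_le ρ₁ (le_iSup_of_le σ₁ (le_iSup_of_le hρ₁
      (le_iSup_of_le hσ₁ le_rfl))))
  rw [sandwiched_sub_le_coe_iff hα (hρ₁.sandwichedQ_pos hσ₁ hα)] at h1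
  obtain ⟨h2, h3⟩ := h1 hs₁
  rw [ampliation_smul, ampliation_smul, sandwichedQ_smul hρ₁.1 hσ₁.1 ht.le hu.le hα,
    sandwichedQ_smul (hN _ _ hρ₁.1) (hM _ _ hσ₁.1) ht.le hu.le hα]
  refine ⟨h2.smul _ hu0, ?_⟩
  calc _ ≤ t ^ α * u ^ (1 - α) * (2 ^ ((α - 1) * c) * sandwichedQ α ρ₁ σ₁) := by gcongr
    _ = _ := by ring

theorem rpow_pow_exponent (α c : ℝ) (k : ℕ) :
    ((2 : ℝ) ^ ((α - 1) * c)) ^ k = 2 ^ ((α - 1) * (k * c)) := by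
  rw [← Real.rpow_natCast, ← Real.rpow_mul two_pos.le]
  congr 1; ring

theorem channelDiv_le_of_isAmortizedBound {α c : ℝ} (hα : 1 < α) (hN : IsCompletelyPositive N)
    (hM : IsCompletelyPositive M) (h : IsAmortizedBound α (2 ^ ((α - 1) * c)) N M) :
    channelDiv α N M ≤ c := by
  refine iSup₂_le fun ω hω => ?_
  rw [sandwiched_le_coe_iff hα]
  set H := mpow ω (1 / 2) with hH
  have hHh : Hᴴ = H := (isHermitian_mpow _ _).eq
  have hHH : H * H = ω := by
    obtain ⟨U, d, hU, hd, hω'⟩ := exists_diagonalization_nonneg hω.1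
    rw [hH, hω', mpow_conj_diagonal hU d (by norm_num)]
    calc _ = U * ((diagonal fun i => ((d i ^ (1 / 2 : ℝ) : ℝ) : ℂ)) * (Uᴴ * U) *
          (diagonal fun i => ((d i ^ (1 / 2 : ℝ) : ℝ) : ℂ))) * Uᴴ := by
          simp only [Matrix.mul_assoc]
      _ = _ := by
        rw [hU, Matrix.mul_one, diagonal_mul_diagonal]
        congr 3; ext i
        rw [← Complex.ofReal_mul, ← Real.sqrt_eq_rpow, Real.mul_self_sqrt (hd i)]
  set v : Matrix (X × X) Unit ℂ := of fun p _ => H p.1 p.2 with hv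
  have hamp : ∀ L : Matrix X X ℂ →ₗ[ℂ] Matrix Y Y ℂ, ampliation X L (v * vᴴ) =
      H ⊗ₖ (1 : Matrix Y Y ℂ) * choi L * H ⊗ₖ (1 : Matrix Y Y ℂ) := by
    intro L
    have e : (of fun r x => v (r, x) () : Matrix X X ℂ) = H := rfl
    rw [ampliation_pure, e, conjTranspose_kronecker_one, hHh]
  have hP : (v * vᴴ).PosSemidef := posSemidef_self_mul_conjTranspose v
  -- Both inputs are the same vector state built from ω^{1/2}; its Q is at most its trace, which is
  -- tr ω = 1.
  obtain ⟨h1, h2⟩ := h.ampliation hα hN hM hP hP (SuppLE.refl _)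
  rw [hamp, hamp] at h1 h2
  refine ⟨h1, h2.trans (mul_le_of_le_one_right (by positivity) ?_)⟩
  refine (sandwichedQ_self hP hα).trans (le_of_eq ?_)
  have h3 : (v * vᴴ).trace = (H * Hᴴ).trace := by
    simp only [trace, diag_apply, Matrix.mul_apply, Fintype.sum_prod_type, conjTranspose_apply, hv,
      of_apply, Finset.univ_unique, Finset.sum_singleton]
  rw [h3, hHh, hHH, hω.2, Complex.one_re]

theorem normalizedDiv_le_iff {α c : ℝ} {k : ℕ} (hk : k ≠ 0) :
    normalizedDiv α N M k ≤ c ↔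
      channelDiv α (tensorPower k N) (tensorPower k M) ≤ ((k * c : ℝ) : EReal) := by
  have : (0 : ℝ) < k := by exact_mod_cast Nat.pos_of_ne_zero hk
  rw [normalizedDiv, coe_mul_le_coe_iff (by positivity), div_div_eq_mul_div, div_one, mul_comm c]

theorem normalizedDiv_le_amortizedDiv {α : ℝ} (hα : 1 < α) (hN : IsCompletelyPositive N)
    (hM : IsCompletelyPositive M) {k : ℕ} (hk : k ≠ 0) :
    normalizedDiv α N M k ≤ amortizedDiv α N M := by
  rw [← EReal.le_of_forall_lt_iff_le]
  intro c hc
  rw [normalizedDiv_le_iff hk]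
  have h := (isAmortizedBound_of_amortizedDiv_le hα hN hM hc.le).tensorPower hα (by positivity)
    hN hM k
  rw [rpow_pow_exponent] at h
  exact channelDiv_le_of_isAmortizedBound hα (hN.tensorPower k) (hM.tensorPower k) h

end Amortization

/-! ### The amortized divergence as the limit. -/

section Regularization

variable {X Y R : Type*} [Fintype X] [DecidableEq X] [Fintype Y] [DecidableEq Y]
  [Fintype R] [DecidableEq R]

/-- The `k`-th tensor power of a map, amplified by `k` copies of the reference system `R`, with the
tensor factors of `R ⊗ X` kept together. -/
def groupedTensorPower (R : Type*) [Fintype R] [DecidableEq R] (k : ℕ)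
    (N : Matrix X X ℂ →ₗ[ℂ] Matrix Y Y ℂ) :
    Matrix (Fin k → R × X) (Fin k → R × X) ℂ →ₗ[ℂ] Matrix (Fin k → R × Y) (Fin k → R × Y) ℂ :=
  (reindexLinearEquiv ℂ ℂ (Equiv.arrowProdEquivProdArrow (Fin k) (fun _ => R) fun _ => Y).symm
      (Equiv.arrowProdEquivProdArrow (Fin k) (fun _ => R) fun _ => Y).symm).toLinearMap ∘ₗ
    ampliationLM (Fin k → R) (tensorPower k N) ∘ₗ
    (reindexLinearEquiv ℂ ℂ (Equiv.arrowProdEquivProdArrow (Fin k) (fun _ => R) fun _ => X)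
      (Equiv.arrowProdEquivProdArrow (Fin k) (fun _ => R) fun _ => X)).toLinearMap

theorem groupedTensorPower_apply (k : ℕ) (N : Matrix X X ℂ →ₗ[ℂ] Matrix Y Y ℂ)
    (A : Matrix (Fin k → R × X) (Fin k → R × X) ℂ) :
    groupedTensorPower R k N A = (ampliation (Fin k → R) (tensorPower k N)
      (A.submatrix (Equiv.arrowProdEquivProdArrow (Fin k) (fun _ => R) fun _ => X).symm
        (Equiv.arrowProdEquivProdArrow (Fin k) (fun _ => R) fun _ => X).symm)).submatrix
      (Equiv.arrowProdEquivProdArrow (Fin k) (fun _ => R) fun _ => Y)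
      (Equiv.arrowProdEquivProdArrow (Fin k) (fun _ => R) fun _ => Y) := rfl

/-- Distributivity of the product over the sums; it lets the chain rule treat R ⊗ X as one system
whose tensor power is mapped to a tensor power. -/
theorem groupedTensorPower_tpow (k : ℕ) (N : Matrix X X ℂ →ₗ[ℂ] Matrix Y Y ℂ)
    (A : Matrix (R × X) (R × X) ℂ) :
    groupedTensorPower R k N (tpow k A) = tpow k (ampliation R N A) := by
  ext p q
  have hL : groupedTensorPower R k N (tpow k A) p q = ∑ x : Fin k → X, ∑ x' : Fin k → X,
      (∏ i, A ((p i).1, x i) ((q i).1, x' i)) *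
        ∏ i, N (single (x i) (x' i) 1) (p i).2 (q i).2 := rfl
  have hR : tpow k (ampliation R N A) p q = ∏ i, ∑ x, ∑ x', A ((p i).1, x) ((q i).1, x') *
      N (single x x' 1) (p i).2 (q i).2 := by
    rw [tpow_apply]
    exact Finset.prod_congr rfl fun i _ => ampliation_apply_eq_sum N A (p i).1 (q i).1 (p i).2 (q i).2
  rw [hL, hR, prod_sum_eq_sum_prod]
  refine Finset.sum_congr rfl fun x _ => ?_
  rw [prod_sum_eq_sum_prod]
  exact Finset.sum_congr rfl fun x' _ => Finset.prod_mul_distrib.symm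

/-- The chain rule for k copies bounds the k-th power of the output quantity by that of the desired
bound, up to a polynomial in k; k-th roots along the infinitely many good k remove it. -/
theorem amortizedDiv_le_of_frequently {N M : Matrix X X ℂ →ₗ[ℂ] Matrix Y Y ℂ} {α c : ℝ}
    (hα : 1 < α) (hN : IsCompletelyPositive N) (hM : IsCompletelyPositive M)
    (h : ∃ᶠ k in Filter.atTop, normalizedDiv α N M k ≤ c) : amortizedDiv α N M ≤ c := by
  refine iSup_le fun r => iSup_le fun ρ => iSup_le fun σ => iSup_le fun hρ => iSup_le fun hσ => ?_
  rw [sandwiched_sub_le_coe_iff hα (hρ.sandwichedQ_pos hσ hα)]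
  intro hs
  have hpos : ∀ {L : Matrix X X ℂ →ₗ[ℂ] Matrix Y Y ℂ}, IsCompletelyPositive L →
      ∀ (k : ℕ) (C : Matrix (Fin k → Fin r × X) (Fin k → Fin r × X) ℂ), C.PosSemidef →
        (groupedTensorPower (Fin r) k L C).PosSemidef := by
    intro L hL k C hC
    rw [groupedTensorPower_apply]
    exact ((hL.tensorPower k).ampliation_posSemidef (hC.submatrix _)).submatrix _
  have key : ∀ k : ℕ, k ≠ 0 → normalizedDiv α N M k ≤ c →
      SuppLE (ampliation (Fin r) N ρ) (ampliation (Fin r) M σ) ∧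
      sandwichedQ α (ampliation (Fin r) N ρ) (ampliation (Fin r) M σ) ^ k ≤
        (((k : ℝ) + 1) ^ (Fintype.card (Fin r × X) + Fintype.card (Fin r × Y))) ^ α *
          (2 ^ ((α - 1) * c) * sandwichedQ α ρ σ) ^ k := by
    intro k hk hc
    rw [normalizedDiv_le_iff hk] at hc
    rw [mul_pow, rpow_pow_exponent, mul_comm (2 ^ _ : ℝ)]
    refine sandwichedQ_pow_le_of_positive_maps hk (groupedTensorPower (Fin r) k N)
      (groupedTensorPower (Fin r) k M) (hpos hN k) (hpos hM k) hα (fun v hv => ?_) hρ.1 hσ.1 hs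
      (hN _ _ hρ.1) (hM _ _ hσ.1) (groupedTensorPower_tpow k N ρ) (groupedTensorPower_tpow k M σ)
    set e := Equiv.arrowProdEquivProdArrow (Fin k) (fun _ => Fin r) fun _ => X
    set w := v.submatrix e.symm id with hw
    have hww : (v * vᴴ).submatrix e.symm e.symm = w * wᴴ := rfl
    have hw1 : wᴴ * w = 1 := by
      rw [hw, conjTranspose_submatrix, submatrix_mul_equiv, hv]
      simp
    obtain ⟨h1, h2⟩ := sandwiched_ampliation_pure_le (hN.tensorPower k) (hM.tensorPower k) hα hc
      w hw1
    have hP : (w * wᴴ).PosSemidef := posSemidef_self_mul_conjTranspose w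
    have hN' := (hN.tensorPower k).ampliation_posSemidef hP
    have hM' := (hM.tensorPower k).ampliation_posSemidef hP
    rw [groupedTensorPower_apply, groupedTensorPower_apply, hww, sandwichedQ_submatrix hN' hM' _ hα]
    exact ⟨h1.submatrix hN' hM' _, h2⟩
  -- The term k = 0 is a default value coming from `1 / 0 = 0` and carries no information.
  have hf : ∃ᶠ k in Filter.atTop, normalizedDiv α N M k ≤ c ∧ k ≠ 0 :=
    h.and_eventually (Filter.eventually_ne_atTop 0)
  obtain ⟨k, hk, hk0⟩ := hf.exists
  refine ⟨(key k hk0 hk).1, ?_⟩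
  exact le_of_frequently_pow_le
    (mul_nonneg (by positivity) (sandwichedQ_nonneg hρ.1 hα)) _
    (hf.mono fun k hk => (key k hk.2 hk.1).2)

/-- Any real c above the liminf bounds infinitely many terms, hence the amortized divergence; this
and the termwise bound squeeze the sequence, without any additivity argument. -/
theorem tendsto_normalizedDiv {N M : Matrix X X ℂ →ₗ[ℂ] Matrix Y Y ℂ} {α : ℝ}
    (hα : 1 < α) (hN : IsCompletelyPositive N) (hM : IsCompletelyPositive M) :
    Filter.Tendsto (normalizedDiv α N M) Filter.atTop (nhds (amortizedDiv α N M)) := by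
  refine tendsto_of_le_liminf_of_limsup_le ?_ ?_
  · rw [← EReal.le_of_forall_lt_iff_le]
    intro c hc
    exact amortizedDiv_le_of_frequently hα hN hM
      ((Filter.frequently_lt_of_liminf_lt (by isBoundedDefault) hc).mono fun k hk => hk.le)
  · refine Filter.limsup_le_of_le (by isBoundedDefault) ?_
    filter_upwards [Filter.eventually_ne_atTop 0] with k hk
    exact normalizedDiv_le_amortizedDiv hα hN hM hk

end Regularization

end QDiv

end

theorem mainTheorem5 {X Y : Type*} [Fintype X] [DecidableEq X] [Fintype Y] [DecidableEq Y]
    (N M : Matrix X X ℂ →ₗ[ℂ] Matrix Y Y ℂ)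
    (hN : QDiv.IsCompletelyPositive N) (hM : QDiv.IsCompletelyPositive M)
    (α : ℝ) (hα : 1 < α) :
    Filter.Tendsto (QDiv.normalizedDiv α N M) Filter.atTop (nhds (QDiv.regularizedDiv α N M)) ∧
      QDiv.amortizedDiv α N M = QDiv.regularizedDiv α N M := by
  have h := QDiv.tendsto_normalizedDiv hα hN hM
  have h' : QDiv.regularizedDiv α N M = QDiv.amortizedDiv α N M := h.limUnder_eq
  rw [h']
  exact ⟨h, rfl⟩
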